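/- **Skew Littlewood identity.** Let $q,s\in\mathbb C$ with $s^2q^{2k-1}\ne 1$ for all $k\ge 1$, let $n\ge 0$, and let $x_1,\dots,x_n\in\mathbb C$ satisfy $sx_i\neq 1$ for all $i$ and $$|(x_i-s)(x_j-s)|<|(1-sx_i)(1-sx_j)|\qquad (1\le i<j\le n).$$ For a partition $\lambda$ let $m_i(\lambda)$ be the number of its parts equal to $i$, and $\lambda'$ its conjugate; a partition is even if all its parts are even. Define vertex weights, where $I$ (below) and $j$ (left) count incoming paths, $K$ (above) and $l$ (right) count outgoing paths, $I,K\in\mathbb Z_{\ge0}$, $j,l\in\{0,1\}$: $$L_x(I,0;I,0)=M_x(I,1;I,1)=\tfrac{1-sxq^I}{1-sx},\qquad L_x(I,1;I,1)=M_x(I,0;I,0)=\tfrac{x-sq^I}{1-sx},$$ $$L_x(I,1;I+1,0)=\tfrac{1-q^{I+1}}{1-sx},\quad L_x(I+1,0;I,1)=\tfrac{x(1-s^2q^I)}{1-sx},\quad M_x(I,1;I+1,0)=\tfrac{x(1-q^{I+1})}{1-sx},\quad M_x(I+1,0;I,1)=\tfrac{1-s^2q^I}{1-sx},$$ all other weights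 being $0$. For partitions $\kappa,\lambda$ let $\langle\lambda|\mathcal T(x)|\kappa\rangle$ (respectively $\langle\lambda|\mathcal T^*(x)|\kappa\rangle$) be the partition function of a single row with columns $\dots,3,2,1$ from left to right, weights $L_x$ (respectively $M_x$), $m_i(\kappa)$ paths above and $m_i(\lambda)$ paths below column $i$, state $0$ (respectively $1$) at the far left and summed over the state $0,1$ at the right end. That is, it is the sum over all states $0,1$ of the horizontal edges of the product of the weights of all vertices. Put $$f_{\lambda/\mu}(x_1,\dots,x_n)=\langle\lambda|\mathcal T(x_n)\cdots\mathcal T(x_1)|\mu\rangle,\qquad g_{\mu/\nu}(x_1,\dots,x_n)=\langle\nu|\mathcal T^*(x_1)\cdots\mathcal T^*(x_n)|\mu\rangle,$$ $$b^{el}_\lambda=\prod_{i\ge1}\ \prod_{k=1}^{m_i(\lambda)/2}\frac{1-q^{2k-1}}{1-s^2q^{2k-1}}\qquad(\lambda'\text{ even}).$$ Then, for every partition $\mu$, the series on the left below converges absolutely, the sum on the right has only finitely many non-zero terms, and $$\sum_{\lambda'\text{ even}} b^{el}_\lambda\, f_{\lambda/\mu}(x_1,\dots,x_n)=\prod_{1\le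 i<j\le n}\frac{1-qx_ix_j}{1-x_ix_j}\ \sum_{\nu'\text{ even}} b^{el}_\nu\, g_{\mu/\nu}(x_1,\dots,x_n).$$ -/

import Mathlib

open scoped BigOperators

noncomputable section

namespace SpinHL

/-!  Partitions are Mathlib's `YoungDiagram`s: `lam.rowLen r` is the part number `r + 1` of `lam`
(zero for large `r`), `lam.transpose` is the conjugate partition. -/

/-- `m_i(lam)`, the number of parts of `lam` that are equal to `i` (used for `i ≥ 1`). -/
def mult (lam : YoungDiagram) (i : ℕ) : ℕ := lam.rowLens.count i

/-- A partition is even when all its parts are even. -/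
def IsEvenPartition (lam : YoungDiagram) : Prop := ∀ r : ℕ, Even (lam.rowLen r)

/-- Boltzmann weight `L_{x,s}(I, j; K, l)` of the grey vertex: `I` paths enter from below and `j`
from the left, `K` paths leave upwards and `l` to the right.  It vanishes unless
`I + j = K + l`. -/
def weightL (q s x : ℂ) (I : ℕ) (j : Fin 2) (K : ℕ) (l : Fin 2) : ℂ :=
  match j, l with
  | 0, 0 => if K = I then (1 - s * x * q ^ I) / (1 - s * x) else 0
  | 1, 1 => if K = I then (x - s * q ^ I) / (1 - s * x) else 0
  | 1, 0 => if K = I + 1 then (1 - q ^ (I + 1)) / (1 - s * x) else 0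
  | 0, 1 => if I = K + 1 then x * (1 - s ^ 2 * q ^ K) / (1 - s * x) else 0

/-- Boltzmann weight `M_{x,s}(I, j; K, l)` of the red vertex, with the same path conventions. -/
def weightM (q s x : ℂ) (I : ℕ) (j : Fin 2) (K : ℕ) (l : Fin 2) : ℂ :=
  match j, l with
  | 0, 0 => if K = I then (x - s * q ^ I) / (1 - s * x) else 0
  | 1, 1 => if K = I then (1 - s * x * q ^ I) / (1 - s * x) else 0
  | 1, 0 => if K = I + 1 then x * (1 - q ^ (I + 1)) / (1 - s * x) else 0
  | 0, 1 => if I = K + 1 then (1 - s ^ 2 * q ^ K) / (1 - s * x) else 0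

/-- Partition function of one row with the columns `N, …, 2, 1` (from left to right), vertex
weights `w`, left boundary state `j`, right boundary state `l`, `K c` paths above and `I c` paths
below column `c`.  The sum runs over all configurations `h` of the horizontal edges, where
`h c` is the state of the edge just to the right of column `c + 1`, that is, just to the left of
column `c`. -/
def rowZ (w : ℕ → Fin 2 → ℕ → Fin 2 → ℂ) (N : ℕ) (j l : Fin 2) (K I : ℕ → ℕ) : ℂ :=
  ∑ h : Fin (N + 1) → Fin 2 with h (Fin.last N) = j ∧ h 0 = l,
    ∏ c : Fin N, w (I (c + 1)) (h c.succ) (K (c + 1)) (h c.castSucc)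

/-- If the column `N + 1` is empty and an empty vertex can only transmit the left boundary state
`j`, with weight one, then this column can be dropped. -/
theorem rowZ_succ_of_empty (w : ℕ → Fin 2 → ℕ → Fin 2 → ℂ) (N : ℕ) (j l : Fin 2) (K I : ℕ → ℕ)
    (hw : ∀ k, w 0 j 0 k = if k = j then 1 else 0) (hK : K (N + 1) = 0) (hI : I (N + 1) = 0) :
    rowZ w (N + 1) j l K I = rowZ w N j l K I := by
  unfold rowZ
  symm
  apply Finset.sum_of_injOn (fun h => (Fin.snoc h j : Fin (N + 2) → Fin 2))
  · intro a _ b _ hab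
    simpa using congrArg (fun f : Fin (N + 2) → Fin 2 => Fin.init f) hab
  · intro h hh
    simp only [Finset.coe_filter, Finset.mem_univ, true_and, Set.mem_ofPred_eq] at hh ⊢
    refine ⟨by simp, ?_⟩
    have : (0 : Fin (N + 2)) = Fin.castSucc 0 := rfl
    rw [this, Fin.snoc_castSucc]; exact hh.2
  · intro h hh hn
    simp only [Finset.mem_filter, Finset.mem_univ, true_and] at hh
    rw [Fin.prod_univ_castSucc]
    have hlast : h (Fin.last N).castSucc ≠ j := by
      intro e
      apply hn
      refine ⟨Fin.init h, ?_, ?_⟩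
      · simp only [Finset.coe_filter, Finset.mem_univ, true_and, Set.mem_ofPred_eq]
        exact ⟨e, hh.2⟩
      · conv_rhs => rw [← Fin.snoc_init_self h]
        rw [hh.1]
    have h2 : h (Fin.last N).succ = j := hh.1
    simp only [Fin.val_last, hK, hI, h2, hw, if_neg hlast, mul_zero]
  · intro h hh
    simp only [Finset.mem_filter, Finset.mem_univ, true_and] at hh
    rw [Fin.prod_univ_castSucc]
    have e1 : (Fin.snoc h j : Fin (N + 2) → Fin 2) (Fin.last N).succ = j := by
      rw [Fin.succ_last, Fin.snoc_last]
    simp only [Fin.val_last, hK, hI, e1, hw, Fin.snoc_castSucc, hh.1, if_true, mul_one,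
      Fin.val_castSucc, ← Fin.castSucc_succ]

/-- The one-row partition function on all columns `…, 3, 2, 1`, with the state `j` at the far left,
the partition `top` above and the partition `bot` below.  For the left boundary states in use below
(`0` for the grey row, `1` for the red row) all columns beyond the largest part of `top` and `bot`
are empty, hence have weight one and may be cut off; see `rowPF_weightL_eq`, `rowPF_weightM_eq`. -/
def rowPF (w : ℕ → Fin 2 → ℕ → Fin 2 → ℂ) (j l : Fin 2) (top bot : YoungDiagram) : ℂ :=
  rowZ w (max (top.rowLen 0) (bot.rowLen 0)) j l (mult top) (mult bot)

theorem mult_eq_zero (lam : YoungDiagram) (i : ℕ) (h : lam.rowLen 0 < i) : mult lam i = 0 := by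
  unfold mult
  rw [List.count_eq_zero]
  intro hi
  obtain ⟨r, -, hr⟩ := List.mem_map.1 hi
  have := lam.rowLen_anti 0 r (Nat.zero_le _)
  omega

theorem rowPF_eq_rowZ (w : ℕ → Fin 2 → ℕ → Fin 2 → ℂ) (j l : Fin 2) (top bot : YoungDiagram)
    (hw : ∀ k, w 0 j 0 k = if k = j then 1 else 0) (N : ℕ) (ht : top.rowLen 0 ≤ N)
    (hb : bot.rowLen 0 ≤ N) :
    rowPF w j l top bot = rowZ w N j l (mult top) (mult bot) := by
  unfold rowPF
  induction N, max_le ht hb using Nat.le_induction with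
  | base => rfl
  | succ n hn ih =>
    rw [ih ((le_max_left _ _).trans hn) ((le_max_right _ _).trans hn), rowZ_succ_of_empty _ _ _ _ _ _ hw]
    · exact mult_eq_zero _ _ (Nat.lt_succ_of_le ((le_max_left _ _).trans hn))
    · exact mult_eq_zero _ _ (Nat.lt_succ_of_le ((le_max_right _ _).trans hn))

/-- The cut-off in `rowPF` is immaterial for the grey row with left state `0`. -/
theorem rowPF_weightL_eq (q s x : ℂ) (hx : s * x ≠ 1) (l : Fin 2) (top bot : YoungDiagram) (N : ℕ)
    (ht : top.rowLen 0 ≤ N) (hb : bot.rowLen 0 ≤ N) :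
    rowPF (weightL q s x) 0 l top bot = rowZ (weightL q s x) N 0 l (mult top) (mult bot) := by
  refine rowPF_eq_rowZ _ _ _ _ _ (fun k => ?_) N ht hb
  have : 1 - s * x ≠ 0 := sub_ne_zero.2 hx.symm
  fin_cases k <;> simp [weightL, this]

/-- The cut-off in `rowPF` is immaterial for the red row with left state `1`. -/
theorem rowPF_weightM_eq (q s x : ℂ) (hx : s * x ≠ 1) (l : Fin 2) (top bot : YoungDiagram) (N : ℕ)
    (ht : top.rowLen 0 ≤ N) (hb : bot.rowLen 0 ≤ N) :
    rowPF (weightM q s x) 1 l top bot = rowZ (weightM q s x) N 1 l (mult top) (mult bot) := by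
  refine rowPF_eq_rowZ _ _ _ _ _ (fun k => ?_) N ht hb
  have : 1 - s * x ≠ 0 := sub_ne_zero.2 hx.symm
  fin_cases k <;> simp [weightM, this]

/-- Matrix element `⟨bot| T_0(x) + T_1(x) |top⟩`: grey row, left state `0`, free right state. -/
def rowT (q s x : ℂ) (bot top : YoungDiagram) : ℂ :=
  ∑ l : Fin 2, rowPF (weightL q s x) 0 l top bot

/-- Matrix element `⟨bot| T*_0(x) + T*_1(x) |top⟩`: red row, left state `1`, free right state. -/
def rowTstar (q s x : ℂ) (bot top : YoungDiagram) : ℂ :=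
  ∑ l : Fin 2, rowPF (weightM q s x) 1 l top bot

/-! The sums over intermediate partitions below have only finitely many non-zero terms. -/

theorem mult_pos_rowLen_zero (lam : YoungDiagram) (h : 0 < lam.rowLen 0) :
    0 < mult lam (lam.rowLen 0) := by
  unfold mult
  rw [List.count_pos_iff]
  refine List.mem_map.2 ⟨0, ?_, rfl⟩
  rw [List.mem_range, ← YoungDiagram.mem_iff_lt_colLen, YoungDiagram.mem_iff_lt_rowLen]
  exact h

theorem sum_mult (lam : YoungDiagram) (N : ℕ) (hN : lam.rowLen 0 ≤ N) :
    ∑ c : Fin N, mult lam (c + 1) = lam.colLen 0 := by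
  rw [← YoungDiagram.length_rowLens,
    Fin.sum_univ_eq_sum_range (fun c => mult lam (c + 1)) N]
  have h := Multiset.sum_count_eq_card (s := Finset.Icc 1 N) (m := (lam.rowLens : Multiset ℕ)) (by
    intro a ha
    rw [Multiset.mem_coe] at ha
    have h1 := lam.pos_of_mem_rowLens a ha
    obtain ⟨r, -, hr⟩ := List.mem_map.1 ha
    have h2 := lam.rowLen_anti 0 r (Nat.zero_le _)
    rw [Finset.mem_Icc]; omega)
  rw [Multiset.coe_card] at h
  rw [← h, Finset.range_eq_Ico, Finset.sum_Ico_add' (fun c => mult lam c) 0 N 1]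
  have e : Finset.Ico (0 + 1) (N + 1) = Finset.Icc 1 N := by
    ext a; simp only [Finset.mem_Ico, Finset.mem_Icc]; omega
  rw [e]
  exact Finset.sum_congr rfl fun a _ => (Multiset.coe_count a lam.rowLens).symm

theorem exists_of_rowZ_ne_zero (w : ℕ → Fin 2 → ℕ → Fin 2 → ℂ)
    (hw : ∀ I j K l, w I j K l ≠ 0 → I + (j : ℕ) = K + l)
    (N : ℕ) (j l : Fin 2) (K I : ℕ → ℕ) (h0 : rowZ w N j l K I ≠ 0) :
    ∃ h : Fin (N + 1) → Fin 2, h (Fin.last N) = j ∧ h 0 = l ∧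
      ∀ c : Fin N, I (c + 1) + (h c.succ : ℕ) = K (c + 1) + h c.castSucc := by
  obtain ⟨h, hh, hne⟩ := Finset.exists_ne_zero_of_sum_ne_zero h0
  simp only [Finset.mem_filter, Finset.mem_univ, true_and] at hh
  refine ⟨h, hh.1, hh.2, fun c => hw _ _ _ _ ?_⟩
  exact Finset.prod_ne_zero_iff.1 hne c (Finset.mem_univ c)

theorem rowPF_bounds (w : ℕ → Fin 2 → ℕ → Fin 2 → ℂ)
    (hw : ∀ I j K l, w I j K l ≠ 0 → I + (j : ℕ) = K + l)
    (j l : Fin 2) (top bot : YoungDiagram) (h0 : rowPF w j l top bot ≠ 0) :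
    bot.colLen 0 + (j : ℕ) = top.colLen 0 + l ∧
      (j = 0 → top.rowLen 0 ≤ bot.rowLen 0) ∧ (j = 1 → bot.rowLen 0 ≤ top.rowLen 0) := by
  obtain ⟨h, hj, hl, hc⟩ := exists_of_rowZ_ne_zero w hw _ _ _ _ _ h0
  refine ⟨?_, ?_, ?_⟩
  · have h1 := Finset.sum_congr rfl (fun c (_ : c ∈ Finset.univ) => hc c)
    rw [Finset.sum_add_distrib, Finset.sum_add_distrib, sum_mult _ _ (le_max_right _ _),
      sum_mult _ _ (le_max_left _ _)] at h1
    have h2 := Fin.sum_univ_succ (fun c => (h c : ℕ))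
    have h3 := Fin.sum_univ_castSucc (fun c => (h c : ℕ))
    rw [hj] at h3; rw [hl] at h2
    omega
  · rintro rfl
    by_contra! hlt
    have hN : max (top.rowLen 0) (bot.rowLen 0) = top.rowLen 0 := max_eq_left hlt.le
    generalize hM : max (top.rowLen 0) (bot.rowLen 0) = N at h hj hl hc
    obtain _ | N := N
    · omega
    have h1 := hc (Fin.last N)
    rw [Fin.succ_last, hj] at h1
    simp only [Fin.val_last] at h1
    have h2 := mult_eq_zero bot (N + 1) (by omega)
    have h3 := mult_pos_rowLen_zero top (by omega)
    rw [← hN, hM] at h3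
    simp only [Fin.val_zero] at h1
    omega
  · rintro rfl
    by_contra! hlt
    have hN : max (top.rowLen 0) (bot.rowLen 0) = bot.rowLen 0 := max_eq_right hlt.le
    generalize hM : max (top.rowLen 0) (bot.rowLen 0) = N at h hj hl hc
    obtain _ | N := N
    · omega
    have h1 := hc (Fin.last N)
    rw [Fin.succ_last, hj] at h1
    simp only [Fin.val_last] at h1
    have h2 := mult_eq_zero top (N + 1) (by omega)
    have h3 := mult_pos_rowLen_zero bot (by omega)
    rw [← hN, hM] at h3
    have h4 := (h (Fin.last N).castSucc).isLt
    simp only [Fin.val_one] at h1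
    omega

theorem finite_bounded (a b : ℕ) :
    {lam : YoungDiagram | lam.rowLen 0 ≤ a ∧ lam.colLen 0 ≤ b}.Finite := by
  refine Set.Finite.of_finite_image (f := YoungDiagram.cells)
    ((Finset.finite_toSet ((Finset.range b ×ˢ Finset.range a).powerset)).subset ?_) ?_
  · rintro _ ⟨lam, ⟨h1, h2⟩, rfl⟩
    rw [Finset.mem_coe, Finset.mem_powerset]
    rintro ⟨i, j⟩ hc
    rw [YoungDiagram.mem_cells] at hc
    have h3 := YoungDiagram.mem_iff_lt_rowLen.1 hc
    have h4 := YoungDiagram.mem_iff_lt_colLen.1 hc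
    have h5 := lam.rowLen_anti 0 i (Nat.zero_le _)
    have h6 := lam.colLen_anti 0 j (Nat.zero_le _)
    simp only [Finset.mem_product, Finset.mem_range]
    omega
  · intro lam _ mu _ h
    exact YoungDiagram.ext h

theorem weightL_conservation (q s x : ℂ) (I : ℕ) (j : Fin 2) (K : ℕ) (l : Fin 2)
    (h : weightL q s x I j K l ≠ 0) : I + (j : ℕ) = K + l := by
  fin_cases j <;> fin_cases l <;> simp [weightL] at h ⊢ <;> omega

theorem weightM_conservation (q s x : ℂ) (I : ℕ) (j : Fin 2) (K : ℕ) (l : Fin 2)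
    (h : weightM q s x I j K l ≠ 0) : I + (j : ℕ) = K + l := by
  fin_cases j <;> fin_cases l <;> simp [weightM] at h ⊢ <;> omega

/-- For a given lower partition only finitely many upper ones give a non-zero grey row. -/
theorem finite_rowT (q s x : ℂ) (bot : YoungDiagram) :
    {top : YoungDiagram | rowT q s x bot top ≠ 0}.Finite := by
  refine (finite_bounded (bot.rowLen 0) (bot.colLen 0)).subset fun top h => ?_
  obtain ⟨l, -, hl⟩ := Finset.exists_ne_zero_of_sum_ne_zero h
  obtain ⟨h1, h2, -⟩ := rowPF_bounds _ (weightL_conservation q s x) _ _ _ _ hl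
  exact ⟨h2 rfl, by simp only [Fin.val_zero] at h1; omega⟩

/-- For a given upper partition only finitely many lower ones give a non-zero red row. -/
theorem finite_rowTstar (q s x : ℂ) (top : YoungDiagram) :
    {bot : YoungDiagram | rowTstar q s x bot top ≠ 0}.Finite := by
  refine (finite_bounded (top.rowLen 0) (top.colLen 0)).subset fun bot h => ?_
  obtain ⟨l, -, hl⟩ := Finset.exists_ne_zero_of_sum_ne_zero h
  obtain ⟨h1, -, h2⟩ := rowPF_bounds _ (weightM_conservation q s x) _ _ _ _ hl
  exact ⟨h2 rfl, by have := l.isLt; simp only [Fin.val_one] at h1; omega⟩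

open Classical in
/-- The skew function `f_{lam/mu}(x_1, …, x_n) = ⟨lam| T(x_n) ⋯ T(x_2) T(x_1) |mu⟩` as a matrix
product; only finitely many intermediate partitions `kap` contribute
(`finite_rowT`). -/
def skewF (q s : ℂ) : (n : ℕ) → (Fin n → ℂ) → YoungDiagram → YoungDiagram → ℂ
  | 0, _, lam, mu => if lam = mu then 1 else 0
  | n + 1, x, lam, mu =>
      ∑ᶠ kap : YoungDiagram,
        rowT q s (x (Fin.last n)) lam kap * skewF q s n (fun i => x i.castSucc) kap mu

open Classical in
/-- The dual skew function `g_{mu/nu}(x_1, …, x_n) = ⟨nu| T*(x_1) T*(x_2) ⋯ T*(x_n) |mu⟩` as a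
matrix product; only finitely many intermediate partitions `kap` contribute
(`finite_rowTstar`). -/
def skewG (q s : ℂ) : (n : ℕ) → (Fin n → ℂ) → YoungDiagram → YoungDiagram → ℂ
  | 0, _, mu, nu => if nu = mu then 1 else 0
  | n + 1, x, mu, nu =>
      ∑ᶠ kap : YoungDiagram,
        skewG q s n (fun i => x i.castSucc) kap nu * rowTstar q s (x (Fin.last n)) kap mu

/-- `b^{el}_lam = ∏_{i ≥ 1} ∏_{k=1}^{m_i/2} (1 - q^{2k-1}) / (1 - s² q^{2k-1})`, used when all the
`m_i` are even; `m_i = 0` when `i` exceeds the largest part. -/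
def bel (q s : ℂ) (lam : YoungDiagram) : ℂ :=
  ∏ i ∈ Finset.Icc 1 (lam.rowLen 0), ∏ k ∈ Finset.Icc 1 (mult lam i / 2),
    (1 - q ^ (2 * k - 1)) / (1 - s ^ 2 * q ^ (2 * k - 1))

end SpinHL

end

/-! Let `E = prodVec (evenWeight q s)`, the functional of column contents that represents b^{el},
extended by zero. The left-hand series, cut off at partitions with parts at most N, is a stack of n
grey rows with left states 0 acting on `E`, evaluated at `mu`; the identity is the limit N → ∞. The
proof is by induction on n, with y the last variable.

Reflection (`rowAct_reflect`): on `E` a grey row may be replaced by a red row with the opposite left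
state. This turns the bottom grey row into a red row with left state 1, which is a row of g, but in
the wrong place.

Exchange (`rowAct_exchange`, `exists_exchange_stack`): the Yang–Baxter equation carries this red row
up through the other grey rows. It produces ∏ (1 - q x_i y) / (1 - x_i y) and error terms. Once on
top, the red row joins `mu` to finitely many partitions, and the induction hypothesis applies below
it.

Decay (`summable_stackAct_replicate`): by reflection again, each error term is a grey stack with
exactly two left states equal to 1. Across an empty column the transfer matrix on states is
triangular for `stateCode`. It preserves parity, because odd multiplicities have weight zero in `E`.
For an even nonzero state the diagonal entry has modulus less than 1, since the excited rows can be
grouped in pairs and admissibility bounds each pair. Hence the error terms vanish as empty columns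
are added on the left.

The same estimate for absolute values bounds the truncated stacks uniformly
(`exists_stackAct_zero_le`). This gives absolute convergence, and dominated convergence then
identifies the limit of the truncations with the full series. -/

open scoped BigOperators

noncomputable section

namespace SpinHL

open Filter Topology

/-! ### Rows as operators on functionals of column contents -/

/-- The transposed action of a row with vertex weights `w` and left boundary state `j` on functionals
of the column contents (listed from the leftmost column), summed over the right boundary state. -/
def rowAct {R : Type*} [CommSemiring R] (w : ℕ → Fin 2 → ℕ → Fin 2 → R) :
    Fin 2 → (List ℕ → R) → List ℕ → R
  | _, v, [] => v []
  -- Conservation fixes the lower multiplicity `k + l - j`. The subtraction truncates only for k = l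
  -- = 0, j = 1, where the weights in use vanish.
  | j, v, k :: K => ∑ l : Fin 2,
      w (k + l - j) j k l * rowAct w l (fun I => v ((k + (l : ℕ) - (j : ℕ)) :: I)) K

section rowAct

variable {R : Type*} [CommSemiring R] (w w' : ℕ → Fin 2 → ℕ → Fin 2 → R)

theorem rowAct_sum_mul {ι : Type*} (t : Finset ι) (c : ι → R) (v : ι → List ℕ → R) (j : Fin 2)
    (K : List ℕ) :
    rowAct w j (fun I => ∑ i ∈ t, c i * v i I) K = ∑ i ∈ t, c i * rowAct w j (v i) K := by
  induction K generalizing j v with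
  | nil => simp [rowAct]
  | cons k K ih =>
    simp only [rowAct, ih, Finset.mul_sum]
    rw [Finset.sum_comm]
    exact Finset.sum_congr rfl fun i _ => Finset.sum_congr rfl fun l _ => by ring

theorem rowAct_add (u v : List ℕ → R) (j : Fin 2) (K : List ℕ) :
    rowAct w j (fun I => u I + v I) K = rowAct w j u K + rowAct w j v K := by
  simpa using rowAct_sum_mul w Finset.univ (fun _ : Fin 2 => 1) ![u, v] j K

theorem rowAct_mul (c : R) (v : List ℕ → R) (j : Fin 2) (K : List ℕ) :
    rowAct w j (fun I => c * v I) K = c * rowAct w j v K := by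
  simpa using rowAct_sum_mul w Finset.univ (fun _ : Fin 1 => c) (fun _ => v) j K

theorem rowAct_rowAct_cons (j l : Fin 2) (v : List ℕ → R) (k : ℕ) (K : List ℕ) :
    rowAct w j (rowAct w' l v) (k :: K) = ∑ j' : Fin 2, ∑ l' : Fin 2,
      w (k + j' - j) j k j' * w' (k + j' - j + l' - l) l (k + j' - j) l' *
        rowAct w j' (rowAct w' l' fun I => v ((k + (j' : ℕ) - (j : ℕ) + (l' : ℕ) - (l : ℕ)) :: I)) K := by
  simp only [rowAct, rowAct_sum_mul, Finset.mul_sum, mul_assoc]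

end rowAct

/-! ### Yang–Baxter exchange -/

/-- The Yang–Baxter equation for a red row above a grey row, with free right boundary. -/
theorem rowAct_exchange (q s x y : ℂ) (K : List ℕ) : ∀ v : List ℕ → ℂ,
    ((1 - q * x * y) * rowAct (weightM q s y) 0 (rowAct (weightL q s x) 0 v) K =
      (1 - q * x * y) * rowAct (weightL q s x) 0 (rowAct (weightM q s y) 0 v) K) ∧
    ((1 - q * x * y) * rowAct (weightM q s y) 1 (rowAct (weightL q s x) 1 v) K =
      (1 - q * x * y) * rowAct (weightL q s x) 1 (rowAct (weightM q s y) 1 v) K) ∧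
    ((1 - q * x * y) * rowAct (weightM q s y) 1 (rowAct (weightL q s x) 0 v) K =
      (1 - x * y) * rowAct (weightL q s x) 0 (rowAct (weightM q s y) 1 v) K +
      (1 - q) * x * y * rowAct (weightL q s x) 1 (rowAct (weightM q s y) 0 v) K) ∧
    ((1 - q * x * y) * rowAct (weightM q s y) 0 (rowAct (weightL q s x) 1 v) K =
      q * (1 - x * y) * rowAct (weightL q s x) 1 (rowAct (weightM q s y) 0 v) K +
      (1 - q) * rowAct (weightL q s x) 0 (rowAct (weightM q s y) 1 v) K) := by
  induction K with
  | nil =>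
    intro v
    simp only [rowAct]
    refine ⟨trivial, trivial, ?_, ?_⟩ <;> ring
  | cons k K ih =>
    intro v
    simp only [rowAct_rowAct_cons, Fin.sum_univ_two, Fin.val_zero, Fin.val_one, add_zero, tsub_zero,
      Nat.add_sub_cancel]
    refine ⟨?_, ?_, ?_, ?_⟩
    -- The induction hypotheses are used at each lower multiplicity the peeled column can have.
    -- Their coefficients are that column's weights with the red row on top; what remains is the
    -- one-column Yang–Baxter equation.
    · obtain ⟨h1, -, -, -⟩ := ih fun I => v (k :: I)
      obtain ⟨-, -, h2, h3⟩ := ih fun I => v ((k + 1) :: I)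
      obtain ⟨-, h4, -, -⟩ := ih fun I => v ((k + 1 + 1) :: I)
      simp only [weightL, weightM, if_true]
      linear_combination (y - s * q ^ k) / (1 - s * y) * ((1 - s * x * q ^ k) / (1 - s * x)) * h1
        + (1 - s ^ 2 * q ^ k) / (1 - s * y) * ((1 - s * x * q ^ (k + 1)) / (1 - s * x)) * h2
        + (y - s * q ^ k) / (1 - s * y) * (x * (1 - s ^ 2 * q ^ k) / (1 - s * x)) * h3
        + (1 - s ^ 2 * q ^ k) / (1 - s * y) * (x * (1 - s ^ 2 * q ^ (k + 1)) / (1 - s * x)) * h4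
    -- With both left states 1 the lower multiplicity can drop to `k - 2`, so `k = 0` and `k = 1`
    -- are separated to avoid truncated subtraction.
    · obtain _ | k := k
      · obtain ⟨-, h4, -, -⟩ := ih fun I => v (0 :: I)
        simp [weightL, weightM, -mul_eq_mul_left_iff]
        linear_combination (1 - s * y) / (1 - s * y) * ((x - s) / (1 - s * x)) * h4
      obtain _ | k := k
      · obtain ⟨-, -, h2, h3⟩ := ih fun I => v (0 :: I)
        obtain ⟨-, h4, -, -⟩ := ih fun I => v (1 :: I)
        simp [weightL, weightM, -mul_eq_mul_left_iff]
        linear_combination (1 - s * y * q) / (1 - s * y) * ((x - s * q) / (1 - s * x)) * h4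
          + (1 - s * y * q) / (1 - s * y) * ((1 - q) / (1 - s * x)) * h2
          + (y * (1 - q)) / (1 - s * y) * ((x - s) / (1 - s * x)) * h3
      obtain ⟨h1, -, -, -⟩ := ih fun I => v (k :: I)
      obtain ⟨-, -, h2, h3⟩ := ih fun I => v ((k + 1) :: I)
      obtain ⟨-, h4, -, -⟩ := ih fun I => v ((k + 1 + 1) :: I)
      simp only [weightL, weightM, if_true, Nat.add_sub_cancel]
      linear_combination (1 - s * y * q ^ (k + 2)) / (1 - s * y) * ((x - s * q ^ (k + 2)) / (1 - s * x)) * h4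
          + (1 - s * y * q ^ (k + 2)) / (1 - s * y) * ((1 - q ^ (k + 2)) / (1 - s * x)) * h2
          + (y * (1 - q ^ (k + 2))) / (1 - s * y) * ((x - s * q ^ (k + 1)) / (1 - s * x)) * h3
          + (y * (1 - q ^ (k + 2))) / (1 - s * y) * ((1 - q ^ (k + 1)) / (1 - s * x)) * h1
    · obtain _ | k := k
      · obtain ⟨-, -, h2, h3⟩ := ih fun I => v (0 :: I)
        obtain ⟨-, h4, -, -⟩ := ih fun I => v (1 :: I)
        simp [weightL, weightM, -mul_eq_mul_left_iff]
        linear_combination (1 - s * y) / (1 - s * y) * ((1 - s * x) / (1 - s * x)) * h2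
          + (1 - s * y) / (1 - s * y) * (x * (1 - s ^ 2) / (1 - s * x)) * h4
      obtain ⟨h1, -, -, -⟩ := ih fun I => v (k :: I)
      obtain ⟨-, -, h2, h3⟩ := ih fun I => v ((k + 1) :: I)
      obtain ⟨-, h4, -, -⟩ := ih fun I => v ((k + 1 + 1) :: I)
      simp only [weightL, weightM, if_true, Nat.add_sub_cancel]
      linear_combination (y * (1 - q ^ (k + 1))) / (1 - s * y) * ((1 - s * x * q ^ k) / (1 - s * x)) * h1
        + (1 - s * y * q ^ (k + 1)) / (1 - s * y) * ((1 - s * x * q ^ (k + 1)) / (1 - s * x)) * h2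
        + (y * (1 - q ^ (k + 1))) / (1 - s * y) * (x * (1 - s ^ 2 * q ^ k) / (1 - s * x)) * h3
        + (1 - s * y * q ^ (k + 1)) / (1 - s * y) * (x * (1 - s ^ 2 * q ^ (k + 1)) / (1 - s * x)) * h4
    · obtain _ | k := k
      · obtain ⟨h1, -, -, -⟩ := ih fun I => v (0 :: I)
        obtain ⟨-, -, h2, h3⟩ := ih fun I => v (0 :: I)
        obtain ⟨-, h4, -, -⟩ := ih fun I => v (1 :: I)
        simp [weightL, weightM, -mul_eq_mul_left_iff]
        linear_combination (y - s) / (1 - s * y) * ((x - s) / (1 - s * x)) * h3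
          + (1 - s ^ 2) / (1 - s * y) * ((1 - q) / (1 - s * x)) * h2
          + (1 - s ^ 2) / (1 - s * y) * ((x - s * q) / (1 - s * x)) * h4
      obtain ⟨h1, -, -, -⟩ := ih fun I => v (k :: I)
      obtain ⟨-, -, h2, h3⟩ := ih fun I => v ((k + 1) :: I)
      obtain ⟨-, h4, -, -⟩ := ih fun I => v ((k + 1 + 1) :: I)
      simp only [weightL, weightM, if_true, Nat.add_sub_cancel]
      linear_combination (y - s * q ^ (k + 1)) / (1 - s * y) * ((1 - q ^ (k + 1)) / (1 - s * x)) * h1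
        + (y - s * q ^ (k + 1)) / (1 - s * y) * ((x - s * q ^ (k + 1)) / (1 - s * x)) * h3
        + (1 - s ^ 2 * q ^ (k + 1)) / (1 - s * y) * ((1 - q ^ (k + 2)) / (1 - s * x)) * h2
        + (1 - s ^ 2 * q ^ (k + 1)) / (1 - s * y) * ((x - s * q ^ (k + 2)) / (1 - s * x)) * h4

/-! ### The even functional and reflection -/

/-- The product functional `K ↦ ∏ β(k)`. -/
def prodVec {R : Type*} [CommSemiring R] (β : ℕ → R) (K : List ℕ) : R := (K.map β).prod

/-- The contribution of one column to `b^{el}`, zero for odd multiplicity. -/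
def evenWeight (q s : ℂ) (m : ℕ) : ℂ :=
  if Even m then ∏ k ∈ Finset.Icc 1 (m / 2),
    (1 - q ^ (2 * k - 1)) / (1 - s ^ 2 * q ^ (2 * k - 1)) else 0

theorem evenWeight_zero (q s : ℂ) : evenWeight q s 0 = 1 := by simp [evenWeight]

theorem evenWeight_of_not_even (q s : ℂ) {m : ℕ} (h : ¬Even m) : evenWeight q s m = 0 := if_neg h

/-- This recurrence balances the weight of a path turning from below to the right against that of a
path turning from the left upwards, which is what reflection needs. -/
theorem evenWeight_add_two (q s : ℂ) (hqs : ∀ k : ℕ, 1 ≤ k → s ^ 2 * q ^ (2 * k - 1) ≠ 1) {m : ℕ}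
    (hm : Even m) :
    evenWeight q s (m + 2) * (1 - s ^ 2 * q ^ (m + 1)) = evenWeight q s m * (1 - q ^ (m + 1)) := by
  obtain ⟨r, rfl⟩ := hm
  have h := hqs (r + 1) (by omega)
  have e1 : (r + r + 2) / 2 = r + 1 := by omega
  have e2 : (r + r) / 2 = r := by omega
  have e3 : 2 * (r + 1) - 1 = r + r + 1 := by omega
  have hev : Even (r + r + 2) := ⟨r + 1, by ring⟩
  simp only [evenWeight, if_pos hev, if_pos (Even.add_self r), e1, e2]
  rw [Finset.prod_Icc_succ_top (by omega), e3]
  rw [e3] at h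
  have h' : 1 - s ^ 2 * q ^ (r + r + 1) ≠ 0 := sub_ne_zero.2 h.symm
  rw [mul_assoc, div_mul_cancel₀ _ h']

theorem prodVec_cons {R : Type*} [CommSemiring R] (β : ℕ → R) (k : ℕ) (K : List ℕ) :
    prodVec β (k :: K) = β k * prodVec β K := by simp [prodVec]

theorem rowAct_prodVec_cons {R : Type*} [CommSemiring R] (w : ℕ → Fin 2 → ℕ → Fin 2 → R) (β : ℕ → R)
    (j : Fin 2) (k : ℕ) (K : List ℕ) :
    rowAct w j (prodVec β) (k :: K) = ∑ l : Fin 2,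
      w (k + l - j) j k l * (β (k + l - j) * rowAct w l (prodVec β) K) := by
  simp only [rowAct, prodVec_cons, rowAct_mul]

/-- The reflection relation: on the even functional grey and red rows agree, up to exchanging the
states of the horizontal edges. -/
theorem rowAct_reflect (q s x : ℂ) (hqs : ∀ k : ℕ, 1 ≤ k → s ^ 2 * q ^ (2 * k - 1) ≠ 1)
    (K : List ℕ) :
    rowAct (weightL q s x) 0 (prodVec (evenWeight q s)) K =
        rowAct (weightM q s x) 1 (prodVec (evenWeight q s)) K ∧
      rowAct (weightL q s x) 1 (prodVec (evenWeight q s)) K =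
        rowAct (weightM q s x) 0 (prodVec (evenWeight q s)) K := by
  induction K with
  | nil => simp [rowAct]
  | cons k K ih =>
    obtain ⟨h0, h1⟩ := ih
    simp only [rowAct_prodVec_cons, Fin.sum_univ_two, Fin.val_zero, Fin.val_one, add_zero,
      tsub_zero, Nat.add_sub_cancel, h0, h1]
    obtain _ | m := k
    · have e : ¬Even 1 := by decide
      simp [weightL, weightM, evenWeight_of_not_even q s e]
    -- For odd `k = m + 1` only turning vertices reach an even lower multiplicity, and the
    -- recurrence compares them. For even `k` only straight vertices survive, and their grey and red
    -- weights agree after swapping edge states.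
    · rcases Nat.even_or_odd m with hm | hm
      · have e1 : ¬Even (m + 1) := by simpa [Nat.even_add_one] using hm
        have h2 := evenWeight_add_two q s hqs hm
        simp only [weightL, weightM, if_true, evenWeight_of_not_even q s e1, Nat.add_sub_cancel]
        constructor
        · linear_combination x / (1 - s * x) *
            rowAct (weightM q s x) 0 (prodVec (evenWeight q s)) K * h2
        · linear_combination -1 / (1 - s * x) *
            rowAct (weightM q s x) 1 (prodVec (evenWeight q s)) K * h2
      · have e1 : ¬Even (m + 1 + 1) := by simpa [Nat.even_add_one] using hm
        have e0 : ¬Even m := by simpa using hm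
        simp only [weightL, weightM, if_true, evenWeight_of_not_even q s e1,
          evenWeight_of_not_even q s e0, Nat.add_sub_cancel]
        constructor <;> ring

/-! ### Stacks of rows -/

/-- Successive rows, the row `0` at the top. -/
def stackAct {R : Type*} [CommSemiring R] : (n : ℕ) → (Fin n → ℕ → Fin 2 → ℕ → Fin 2 → R) →
    (Fin n → Fin 2) → (List ℕ → R) → List ℕ → R
  | 0, _, _, v => v
  | n + 1, w, e, v => rowAct (w 0) (e 0) (stackAct n (Fin.tail w) (Fin.tail e) v)

section stackAct

variable {R : Type*} [CommSemiring R]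

theorem stackAct_snoc (n : ℕ) (w : Fin (n + 1) → ℕ → Fin 2 → ℕ → Fin 2 → R)
    (e : Fin (n + 1) → Fin 2) (v : List ℕ → R) :
    stackAct (n + 1) w e v =
      stackAct n (Fin.init w) (Fin.init e) (rowAct (w (Fin.last n)) (e (Fin.last n)) v) := by
  induction n with
  | zero => rfl
  | succ n ih =>
    rw [stackAct, ih, stackAct, Fin.tail_init_eq_init_tail, Fin.tail_init_eq_init_tail]
    rfl

/-- The weight of one column of a stack of rows, summed against the bottom functional `β`. -/
def colWeight (β : ℕ → R) : (n : ℕ) → (Fin n → ℕ → Fin 2 → ℕ → Fin 2 → R) →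
    (Fin n → Fin 2) → (Fin n → Fin 2) → ℕ → R
  | 0, _, _, _, k => β k
  | n + 1, w, e, e', k => w 0 (k + e' 0 - e 0) (e 0) k (e' 0) *
      colWeight β n (Fin.tail w) (Fin.tail e) (Fin.tail e') (k + e' 0 - e 0)

/-- A product functional at the bottom factorises over columns, so the stack can be read from left
to right as a product of transfer matrices on the states of the horizontal edges. -/
theorem stackAct_prodVec_cons (β : ℕ → R) (n : ℕ) (w : Fin n → ℕ → Fin 2 → ℕ → Fin 2 → R)
    (e : Fin n → Fin 2) (k : ℕ) (K : List ℕ) :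
    stackAct n w e (prodVec β) (k :: K) =
      ∑ e' : Fin n → Fin 2, colWeight β n w e e' k * stackAct n w e' (prodVec β) K := by
  induction n generalizing k K with
  | zero => simp [stackAct, colWeight, prodVec]
  | succ n ih =>
    rw [← (Fin.consEquiv fun _ => Fin 2).sum_comp, Fintype.sum_prod_type]
    simp only [stackAct, rowAct, ih, rowAct_sum_mul, Fin.consEquiv, Equiv.coe_fn_mk, colWeight, Fin.cons_zero,
      Fin.tail_cons, Finset.mul_sum, mul_assoc]

end stackAct

theorem rowAct_mul_add_sum {ι : Type*} (t : Finset ι) (c : ι → ℂ) (u : ι → List ℕ → ℂ) (a : ℂ)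
    (v : List ℕ → ℂ) (w : ℕ → Fin 2 → ℕ → Fin 2 → ℂ) (j : Fin 2) (K : List ℕ) :
    rowAct w j (fun I => a * v I + ∑ i ∈ t, c i * u i I) K =
      a * rowAct w j v K + ∑ i ∈ t, c i * rowAct w j (u i) K := by
  rw [rowAct_add, rowAct_mul, rowAct_sum_mul]

/-- Moving an unexcited red row through a stack of unexcited grey rows, up to excited terms. -/
theorem exists_exchange_stack (q s y : ℂ) (n : ℕ) (x : Fin n → ℂ) :
    (∀ (v : List ℕ → ℂ) (K : List ℕ), (∏ i, (1 - q * x i * y)) *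
      rowAct (weightM q s y) 0 (stackAct n (fun i => weightL q s (x i)) 0 v) K =
      (∏ i, (1 - q * x i * y)) *
        stackAct n (fun i => weightL q s (x i)) 0 (rowAct (weightM q s y) 0 v) K) ∧
    ∃ C : Fin n → ℂ, ∀ (v : List ℕ → ℂ) (K : List ℕ), (∏ i, (1 - q * x i * y)) *
      rowAct (weightM q s y) 1 (stackAct n (fun i => weightL q s (x i)) 0 v) K =
      (∏ i, (1 - x i * y)) *
        stackAct n (fun i => weightL q s (x i)) 0 (rowAct (weightM q s y) 1 v) K +
      ∑ k, C k * stackAct n (fun i => weightL q s (x i)) (Pi.single k 1)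
        (rowAct (weightM q s y) 0 v) K := by
  induction n with
  | zero => simp [stackAct]
  | succ n ih =>
    obtain ⟨ih0, C, ih1⟩ := ih (Fin.tail x)
    have t0 : Fin.tail (0 : Fin (n + 1) → Fin 2) = 0 := rfl
    have tw : Fin.tail (fun i => weightL q s (x i)) = fun i => weightL q s (Fin.tail x i) := rfl
    have ts (k : Fin n) : Fin.tail (Pi.single k.succ 1 : Fin (n + 1) → Fin 2) = Pi.single k 1 := by
      ext i; simp [Fin.tail, Pi.single_apply]
    have tx (i : Fin n) : x i.succ = Fin.tail x i := rfl
    have t1 : Fin.tail (Pi.single 0 1 : Fin (n + 1) → Fin 2) = 0 := by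
      ext i; simp [Fin.tail]
    have push0 (v : List ℕ → ℂ) (j : Fin 2) (K : List ℕ) :
        (∏ i, (1 - q * Fin.tail x i * y)) * rowAct (weightL q s (x 0)) j (rowAct (weightM q s y) 0
          (stackAct n (fun i => weightL q s (Fin.tail x i)) 0 v)) K =
        (∏ i, (1 - q * Fin.tail x i * y)) * rowAct (weightL q s (x 0)) j
          (stackAct n (fun i => weightL q s (Fin.tail x i)) 0 (rowAct (weightM q s y) 0 v)) K := by
      rw [← rowAct_mul, ← rowAct_mul, funext (ih0 v)]
    have push1 (v : List ℕ → ℂ) (K : List ℕ) :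
        (∏ i, (1 - q * Fin.tail x i * y)) * rowAct (weightL q s (x 0)) 0 (rowAct (weightM q s y) 1
          (stackAct n (fun i => weightL q s (Fin.tail x i)) 0 v)) K =
        (∏ i, (1 - Fin.tail x i * y)) * rowAct (weightL q s (x 0)) 0
          (stackAct n (fun i => weightL q s (Fin.tail x i)) 0 (rowAct (weightM q s y) 1 v)) K +
        ∑ k, C k * rowAct (weightL q s (x 0)) 0 (stackAct n (fun i => weightL q s (Fin.tail x i))
          (Pi.single k 1) (rowAct (weightM q s y) 0 v)) K := by
      rw [← rowAct_mul, funext (ih1 v), rowAct_mul_add_sum]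
    -- The exchange with the top grey row either leaves it in state 0, with factor `1 - x 0 * y`, or
    -- excites it and puts the red row in state 0. In the second case the red row passes the
    -- remaining rows by the first claim, so only one grey row is ever excited.
    refine ⟨fun v K => ?_, Fin.cons ((1 - q) * x 0 * y * ∏ i, (1 - q * Fin.tail x i * y))
      (fun k => (1 - x 0 * y) * C k), fun v K => ?_⟩
    · obtain ⟨h, -, -, -⟩ := rowAct_exchange q s (x 0) y K
        (stackAct n (fun i => weightL q s (Fin.tail x i)) 0 v)
      simp only [stackAct, Fin.prod_univ_succ, t0, tw, tx, Pi.zero_apply]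
      linear_combination (∏ i, (1 - q * Fin.tail x i * y)) * h + (1 - q * x 0 * y) * push0 v 0 K
    · obtain ⟨-, -, h, -⟩ := rowAct_exchange q s (x 0) y K
        (stackAct n (fun i => weightL q s (Fin.tail x i)) 0 v)
      simp only [stackAct, Fin.prod_univ_succ, Fin.sum_univ_succ, t0, t1, ts, tw, tx, Pi.zero_apply,
        Fin.cons_zero, Fin.cons_succ, Pi.single_eq_same, mul_assoc (1 - x 0 * y),
        ← Finset.mul_sum, Pi.single_eq_of_ne (Fin.succ_ne_zero _).symm]
      linear_combination (∏ i, (1 - q * Fin.tail x i * y)) * h + (1 - x 0 * y) * push1 v K +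
        (1 - q) * x 0 * y * push0 v 1 K

/-! ### Decay along empty columns -/

/-- Summing the recursion bounds each partial sum S by a 0 + r S + ∑ b, hence by (a 0 + ∑ b) / (1 -
r). -/
theorem summable_of_le_mul_add {a b : ℕ → ℝ} {r : ℝ} (hr : r < 1) (ha : ∀ N, 0 ≤ a N)
    (hb0 : ∀ N, 0 ≤ b N) (hb : Summable b) (h : ∀ N, a (N + 1) ≤ r * a N + b N) : Summable a := by
  refine summable_of_sum_range_le (c := (a 0 + ∑' N, b N) / (1 - r)) ha fun M => ?_
  rw [le_div_iff₀ (sub_pos.2 hr)]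
  have h1 : ∑ N ∈ Finset.range M, a (N + 1) ≤
      r * ∑ N ∈ Finset.range M, a N + ∑ N ∈ Finset.range M, b N := by
    rw [Finset.mul_sum, ← Finset.sum_add_distrib]
    exact Finset.sum_le_sum fun N _ => h N
  have h2 := hb.sum_le_tsum (Finset.range M) fun N _ => hb0 N
  have h3 := Finset.sum_range_succ' a M
  have h4 := Finset.sum_range_succ a M
  have h5 := ha M
  linarith

/-- Factors are removed two at a time. Evenness is essential, since a single factor may exceed 1. -/
theorem prod_lt_one_of_pairwise {ι : Type*} [DecidableEq ι] (a : ι → ℝ) (ha : ∀ i, 0 ≤ a i)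
    (hp : ∀ i j, i ≠ j → a i * a j < 1) (t : Finset ι) :
    Even t.card → t.Nonempty → ∏ i ∈ t, a i < 1 := by
  induction t using Finset.strongInduction with
  | H t ih =>
    intro hev hne
    have hc : 1 < t.card := by
      have := hne.card_pos
      rw [Nat.even_iff] at hev
      omega
    obtain ⟨i, hi, j, hj, hij⟩ := Finset.one_lt_card.1 hc
    have hj' : j ∈ t.erase i := Finset.mem_erase.2 ⟨hij.symm, hj⟩
    rw [← Finset.mul_prod_erase t a hi, ← Finset.mul_prod_erase _ a hj', ← mul_assoc]
    have hle : ∏ k ∈ (t.erase i).erase j, a k ≤ 1 := by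
      rcases ((t.erase i).erase j).eq_empty_or_nonempty with h | h
      · simp [h]
      · refine (ih _ ((Finset.erase_ssubset hj').trans (Finset.erase_ssubset hi)) ?_ h).le
        rw [Finset.card_erase_of_mem hj', Finset.card_erase_of_mem hi]
        rw [Nat.even_iff] at hev ⊢
        omega
    calc _ ≤ a i * a j * 1 := mul_le_mul_of_nonneg_left hle (mul_nonneg (ha i) (ha j))
      _ < 1 := by rw [mul_one]; exact hp i j hij

/-- A binary code for the states of a stack, compatible with the lexicographic order. -/
def stateCode : (n : ℕ) → (Fin n → Fin 2) → ℕ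
  | 0, _ => 0
  | n + 1, e => (e 0 : ℕ) * 2 ^ n + stateCode n (Fin.tail e)

theorem stateCode_lt (n : ℕ) (e : Fin n → Fin 2) : stateCode n e < 2 ^ n := by
  induction n with
  | zero => simp [stateCode]
  | succ n ih =>
    have h := ih (Fin.tail e)
    have h2 : (e 0 : ℕ) * 2 ^ n ≤ 1 * 2 ^ n := Nat.mul_le_mul_right _ (by omega)
    rw [stateCode, pow_succ]
    omega

theorem stateCode_zero (n : ℕ) : stateCode n 0 = 0 := by
  induction n with
  | zero => rfl
  | succ n ih =>
    have : Fin.tail (0 : Fin (n + 1) → Fin 2) = 0 := rfl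
    simp [stateCode, this, ih]

section decay

variable {n : ℕ} {w : Fin n → ℕ → Fin 2 → ℕ → Fin 2 → ℝ} {β : ℕ → ℝ}

theorem colWeight_nonneg {R : Type*} [CommSemiring R] [PartialOrder R] [IsOrderedRing R]
    {w : Fin n → ℕ → Fin 2 → ℕ → Fin 2 → R} {β : ℕ → R}
    (hw : ∀ i I j K l, 0 ≤ w i I j K l) (hβ : ∀ k, 0 ≤ β k)
    (e e' : Fin n → Fin 2) (k : ℕ) : 0 ≤ colWeight β n w e e' k := by
  induction n generalizing k with
  | zero => exact hβ k
  | succ n ih => exact mul_nonneg (hw ..) (ih (fun i => hw i.succ) _ _ _)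

/-- By conservation the multiplicity at the bottom has the parity of this sum, and `β` is supported
on even numbers. -/
theorem even_of_colWeight_ne_zero
    (hw : ∀ i I j K l, w i I j K l ≠ 0 → I + (j : ℕ) = K + l) (hβ : ∀ k, β k ≠ 0 → Even k)
    (e e' : Fin n → Fin 2) (k : ℕ) (h : colWeight β n w e e' k ≠ 0) :
    Even (k + ∑ i, (e' i : ℕ) + ∑ i, (e i : ℕ)) := by
  induction n generalizing k with
  | zero => simpa using hβ k h
  | succ n ih =>
    have h1 := hw _ _ _ _ _ (left_ne_zero_of_mul h)
    have h2 := ih (fun i => hw i.succ) _ _ _ (right_ne_zero_of_mul h)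
    rw [Fin.sum_univ_succ, Fin.sum_univ_succ]
    simp only [Fin.tail] at h2
    rw [Nat.even_iff] at h2 ⊢
    omega

/-- With no path leaving at the top, rows whose state is unchanged receive no path from below. At
the first row that changes, conservation only allows 0 to become 1, which raises the code whatever
happens further down. -/
theorem eq_or_stateCode_lt_of_colWeight_ne_zero
    (hw : ∀ i I j K l, w i I j K l ≠ 0 → I + (j : ℕ) = K + l)
    (e e' : Fin n → Fin 2) (h : colWeight β n w e e' 0 ≠ 0) :
    e = e' ∨ stateCode n e < stateCode n e' := by
  induction n with
  | zero => exact Or.inl (Subsingleton.elim _ _)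
  | succ n ih =>
    have h1 := hw _ _ _ _ _ (left_ne_zero_of_mul h)
    have h2 := right_ne_zero_of_mul h
    simp only [stateCode]
    rcases (show (e 0 : ℕ) ≤ e' 0 by omega).eq_or_lt with he | he
    · rw [he, show 0 + (e' 0 : ℕ) - (e' 0 : ℕ) = 0 by omega] at h2
      rcases ih (fun i => hw i.succ) _ _ h2 with h3 | h3
      · left
        ext i
        refine Fin.cases he (fun i => ?_) i
        exact congrArg Fin.val (congrFun h3 i)
      · right
        rw [he]
        omega
    · right
      have h3 := stateCode_lt n (Fin.tail e)
      have h4 := (e' 0).isLt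
      rw [show (e 0 : ℕ) = 0 by omega, show (e' 0 : ℕ) = 1 by omega]
      omega

theorem colWeight_self (e : Fin n → Fin 2) :
    colWeight β n w e e 0 = (∏ i, w i 0 (e i) 0 (e i)) * β 0 := by
  induction n with
  | zero => simp [colWeight]
  | succ n ih =>
    have : 0 + (e 0 : ℕ) - (e 0 : ℕ) = 0 := by omega
    rw [colWeight, this, ih, Fin.prod_univ_succ, mul_assoc]
    rfl

theorem colWeight_self_lt_one (hw0 : ∀ i I j K l, 0 ≤ w i I j K l) (hvac : ∀ i, w i 0 0 0 0 ≤ 1)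
    (hexc : ∀ i j, i ≠ j → w i 0 1 0 1 * w j 0 1 0 1 < 1) (hβ : β 0 = 1)
    (e : Fin n → Fin 2) (he : e ≠ 0) (hev : Even (∑ i, (e i : ℕ))) :
    colWeight β n w e e 0 < 1 := by
  rw [colWeight_self, hβ, mul_one]
  have hs : ∑ i, (e i : ℕ) = (Finset.univ.filter fun i => e i = 1).card := by
    rw [Finset.card_filter]
    refine Finset.sum_congr rfl fun i _ => ?_
    generalize e i = a
    fin_cases a <;> rfl
  have hne : (Finset.univ.filter fun i => e i = 1).Nonempty := by
    by_contra hemp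
    apply he
    ext i
    have := Finset.not_nonempty_iff_eq_empty.1 hemp
    have hi := Finset.eq_empty_iff_forall_notMem.1 this i
    simp only [Finset.mem_filter, Finset.mem_univ, true_and] at hi
    rw [Pi.zero_apply]
    generalize e i = a at hi
    fin_cases a <;> simp_all
  refine lt_of_le_of_lt ?_
    (prod_lt_one_of_pairwise (fun i => w i 0 1 0 1) (fun i => hw0 ..) hexc _ (hs ▸ hev) hne)
  rw [Finset.prod_filter]
  refine Finset.prod_le_prod (fun i _ => hw0 ..) fun i _ => ?_
  have := hvac i
  generalize e i = a
  fin_cases a <;> simp_all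

theorem rowAct_nonneg {w : ℕ → Fin 2 → ℕ → Fin 2 → ℝ} (hw : ∀ I j K l, 0 ≤ w I j K l)
    {v : List ℕ → ℝ} (hv : ∀ K, 0 ≤ v K) (j : Fin 2) (K : List ℕ) : 0 ≤ rowAct w j v K := by
  induction K generalizing j v with
  | nil => exact hv _
  | cons k K ih => exact Finset.sum_nonneg fun l _ => mul_nonneg (hw ..) (ih (fun _ => hv _) _)

theorem stackAct_nonneg (hw : ∀ i I j K l, 0 ≤ w i I j K l) {v : List ℕ → ℝ} (hv : ∀ K, 0 ≤ v K)
    (e : Fin n → Fin 2) (K : List ℕ) : 0 ≤ stackAct n w e v K := by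
  induction n generalizing K with
  | zero => exact hv K
  | succ n ih => exact rowAct_nonneg (hw 0) (fun K => ih (fun i => hw i.succ) _ K) _ _

theorem prodVec_nonneg (hβ : ∀ k, 0 ≤ β k) (K : List ℕ) : 0 ≤ prodVec β K :=
  List.prod_nonneg fun a ha => by
    obtain ⟨k, -, rfl⟩ := List.mem_map.1 ha
    exact hβ k

/-- Evenly excited states decay along the empty columns on the left. -/
theorem summable_stackAct_replicate (hw0 : ∀ i I j K l, 0 ≤ w i I j K l)
    (hw : ∀ i I j K l, w i I j K l ≠ 0 → I + (j : ℕ) = K + l) (hvac : ∀ i, w i 0 0 0 0 ≤ 1)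
    (hexc : ∀ i j, i ≠ j → w i 0 1 0 1 * w j 0 1 0 1 < 1) (hβ0 : ∀ k, 0 ≤ β k) (hβ : β 0 = 1)
    (hβe : ∀ k, β k ≠ 0 → Even k) (K : List ℕ) (e : Fin n → Fin 2) (he : e ≠ 0)
    (hev : Even (∑ i, (e i : ℕ))) :
    Summable fun N => stackAct n w e (prodVec β) (List.replicate N 0 ++ K) := by
  -- Induction on the distance of the code from its bound `2 ^ n`, since transitions to another
  -- state increase the code.
  obtain ⟨m, hm⟩ : ∃ m, m = 2 ^ n - stateCode n e := ⟨_, rfl⟩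
  induction m using Nat.strong_induction_on generalizing e with
  | _ m ih =>
    have hnn := fun e' K' => stackAct_nonneg hw0 (prodVec_nonneg hβ0) e' K'
    refine summable_of_le_mul_add (b := fun N => ∑ e' ∈ Finset.univ.erase e,
      colWeight β n w e e' 0 * stackAct n w e' (prodVec β) (List.replicate N 0 ++ K))
      (colWeight_self_lt_one hw0 hvac hexc hβ e he hev)
      (fun N => hnn _ _)
      (fun N => Finset.sum_nonneg fun e' _ => mul_nonneg (colWeight_nonneg hw0 hβ0 _ _ _) (hnn _ _))
      (summable_sum fun e' he' => ?_) fun N => ?_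
    · by_cases h0 : colWeight β n w e e' 0 = 0
      · simp only [h0, zero_mul]
        exact summable_zero
      · have hlt := (eq_or_stateCode_lt_of_colWeight_ne_zero hw e e' h0).resolve_left
          (Finset.ne_of_mem_erase he').symm
        have h1 := stateCode_lt n e'
        refine (ih _ ?_ e' ?_ ?_ rfl).mul_left _
        · omega
        · rintro rfl
          rw [stateCode_zero] at hlt
          omega
        · have := even_of_colWeight_ne_zero hw hβe e e' 0 h0
          rw [Nat.even_iff] at this hev ⊢
          omega
    · rw [List.replicate_succ, List.cons_append, stackAct_prodVec_cons,
        ← Finset.add_sum_erase _ _ (Finset.mem_univ e)]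

/-- For the state 0 the diagonal entry is only known to be at most 1. The contributions of the other
states form a summable series, so the recursion still gives a uniform bound; this is why decay is
stated as summability. -/
theorem exists_stackAct_zero_le (hw0 : ∀ i I j K l, 0 ≤ w i I j K l)
    (hw : ∀ i I j K l, w i I j K l ≠ 0 → I + (j : ℕ) = K + l) (hvac : ∀ i, w i 0 0 0 0 ≤ 1)
    (hexc : ∀ i j, i ≠ j → w i 0 1 0 1 * w j 0 1 0 1 < 1) (hβ0 : ∀ k, 0 ≤ β k) (hβ : β 0 = 1)
    (hβe : ∀ k, β k ≠ 0 → Even k) (K : List ℕ) :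
    ∃ C, ∀ N, stackAct n w 0 (prodVec β) (List.replicate N 0 ++ K) ≤ C := by
  have hnn := fun e' K' => stackAct_nonneg hw0 (prodVec_nonneg hβ0) e' K'
  set b : ℕ → ℝ := fun N => ∑ e' ∈ Finset.univ.erase 0,
      colWeight β n w 0 e' 0 * stackAct n w e' (prodVec β) (List.replicate N 0 ++ K) with hb
  have hb0 : ∀ N, 0 ≤ b N := fun N =>
    Finset.sum_nonneg fun e' _ => mul_nonneg (colWeight_nonneg hw0 hβ0 _ _ _) (hnn _ _)
  have hsum : Summable b := by
    refine summable_sum fun e' he' => ?_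
    by_cases h0 : colWeight β n w 0 e' 0 = 0
    · simp only [h0, zero_mul]
      exact summable_zero
    · refine (summable_stackAct_replicate hw0 hw hvac hexc hβ0 hβ hβe K e'
        (Finset.ne_of_mem_erase he') ?_).mul_left _
      simpa using even_of_colWeight_ne_zero hw hβe 0 e' 0 h0
  have hstep : ∀ N, stackAct n w 0 (prodVec β) (List.replicate (N + 1) 0 ++ K) ≤
      stackAct n w 0 (prodVec β) (List.replicate N 0 ++ K) + b N := by
    intro N
    rw [List.replicate_succ, List.cons_append, stackAct_prodVec_cons,
      ← Finset.add_sum_erase _ _ (Finset.mem_univ 0), colWeight_self, hβ, mul_one]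
    refine add_le_add_left (mul_le_of_le_one_left (hnn _ _) ?_) _
    exact Finset.prod_le_one (fun i _ => hw0 ..) fun i _ => hvac i
  refine ⟨stackAct n w 0 (prodVec β) K + ∑' N, b N, fun N => ?_⟩
  refine le_trans ?_ (add_le_add_right (hsum.sum_le_tsum (Finset.range N) fun N _ => hb0 N) _)
  induction N with
  | zero => simp
  | succ N ih =>
    rw [Finset.sum_range_succ]
    linarith [hstep N]

end decay

/-! ### Domination by absolute values -/

/-- Domination of a stack by the stack of absolute values. -/
theorem norm_rowAct_le {w : ℕ → Fin 2 → ℕ → Fin 2 → ℂ} {v : List ℕ → ℂ} {v' : List ℕ → ℝ}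
    (hv : ∀ K, ‖v K‖ ≤ v' K) (j : Fin 2) (K : List ℕ) :
    ‖rowAct w j v K‖ ≤ rowAct (fun I j K l => ‖w I j K l‖) j v' K := by
  induction K generalizing j v v' with
  | nil => exact hv _
  | cons k K ih =>
    refine (norm_sum_le _ _).trans (Finset.sum_le_sum fun l _ => ?_)
    rw [norm_mul]
    exact mul_le_mul_of_nonneg_left (ih (fun _ => hv _) _) (norm_nonneg _)

theorem norm_stackAct_le {n : ℕ} {w : Fin n → ℕ → Fin 2 → ℕ → Fin 2 → ℂ} {v : List ℕ → ℂ}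
    {v' : List ℕ → ℝ} (hv : ∀ K, ‖v K‖ ≤ v' K) (e : Fin n → Fin 2) (K : List ℕ) :
    ‖stackAct n w e v K‖ ≤ stackAct n (fun i I j K l => ‖w i I j K l‖) e v' K := by
  induction n generalizing K with
  | zero => exact hv K
  | succ n ih => exact norm_rowAct_le (fun K => ih _ K) _ _

theorem norm_prodVec (β : ℕ → ℂ) (K : List ℕ) : ‖prodVec β K‖ = prodVec (fun k => ‖β k‖) K := by
  induction K with
  | nil => simp [prodVec]
  | cons k K ih => rw [prodVec_cons, prodVec_cons, norm_mul, ih]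

/-! ### Partitions and their column contents -/

/-- The column contents `m_N, …, m_1` of a partition. -/
def cols (lam : YoungDiagram) : ℕ → List ℕ
  | 0 => []
  | N + 1 => mult lam (N + 1) :: cols lam N

theorem length_cols (lam : YoungDiagram) (N : ℕ) : (cols lam N).length = N := by
  induction N with
  | zero => rfl
  | succ N ih => simp [cols, ih]

theorem cols_add (lam : YoungDiagram) (N M : ℕ) (h : lam.rowLen 0 ≤ N) :
    cols lam (M + N) = List.replicate M 0 ++ cols lam N := by
  induction M with
  | zero => simp
  | succ M ih =>
    rw [show M + 1 + N = M + N + 1 by ring, cols, ih, mult_eq_zero lam _ (by omega)]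
    rfl

theorem mult_eq_of_cols_eq {lam mu : YoungDiagram} {N : ℕ} (h : cols lam N = cols mu N) (i : ℕ)
    (hi : 1 ≤ i) (hN : i ≤ N) : mult lam i = mult mu i := by
  induction N with
  | zero => omega
  | succ N ih =>
    rw [cols, cols, List.cons.injEq] at h
    rcases hN.eq_or_lt with rfl | h'
    · exact h.1
    · exact ih h.2 (by omega)

theorem mult_zero (lam : YoungDiagram) : mult lam 0 = 0 := by
  rw [mult, List.count_eq_zero]
  exact fun h => (lam.pos_of_mem_rowLens 0 h).ne rfl

theorem cols_injective {lam mu : YoungDiagram} {N : ℕ} (hl : lam.rowLen 0 ≤ N) (hm : mu.rowLen 0 ≤ N)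
    (h : cols lam N = cols mu N) : lam = mu := by
  apply YoungDiagram.equivListRowLens.injective
  apply Subtype.ext
  have hp : lam.rowLens.Perm mu.rowLens := by
    rw [List.perm_iff_count]
    intro i
    change mult lam i = mult mu i
    rcases Nat.eq_zero_or_pos i with rfl | hi
    · rw [mult_zero, mult_zero]
    · rcases le_or_gt i N with hi' | hi'
      · exact mult_eq_of_cols_eq h i hi hi'
      · rw [mult_eq_zero _ _ (by omega), mult_eq_zero _ _ (by omega)]
  exact hp.eq_of_sortedGE lam.rowLens_sorted mu.rowLens_sorted

/-- The parts of the partition with given column contents. -/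
def rowsOfCols : List ℕ → List ℕ
  | [] => []
  | i :: I => List.replicate i (I.length + 1) ++ rowsOfCols I

theorem le_of_mem_rowsOfCols (I : List ℕ) (a : ℕ) (h : a ∈ rowsOfCols I) : 0 < a ∧ a ≤ I.length := by
  induction I with
  | nil => simp [rowsOfCols] at h
  | cons i I ih =>
    rw [rowsOfCols, List.mem_append] at h
    rw [List.length_cons]
    rcases h with h | h
    · have := List.eq_of_mem_replicate h
      omega
    · have := ih h
      omega

theorem sortedGE_rowsOfCols (I : List ℕ) : (rowsOfCols I).SortedGE := by
  rw [List.sortedGE_iff_pairwise]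
  induction I with
  | nil => exact List.Pairwise.nil
  | cons i I ih =>
    rw [rowsOfCols, List.pairwise_append]
    refine ⟨List.pairwise_replicate.2 (Or.inr le_rfl), ih, fun a ha b hb => ?_⟩
    have h1 := List.eq_of_mem_replicate ha
    have h2 := le_of_mem_rowsOfCols I b hb
    omega

theorem exists_cols_eq (I : List ℕ) :
    ∃ lam : YoungDiagram, lam.rowLen 0 ≤ I.length ∧ cols lam I.length = I := by
  have hpos : ∀ a ∈ rowsOfCols I, 0 < a := fun a h => (le_of_mem_rowsOfCols I a h).1
  set lam := YoungDiagram.ofRowLens (rowsOfCols I) (sortedGE_rowsOfCols I) with hlam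
  have hr : lam.rowLens = rowsOfCols I := YoungDiagram.rowLens_ofRowLens_eq_self hpos
  refine ⟨lam, ?_, ?_⟩
  · by_contra! h
    have h1 := mult_pos_rowLen_zero lam (by omega)
    rw [mult, List.count_pos_iff, hr] at h1
    have := le_of_mem_rowsOfCols I _ h1
    omega
  · have hm : ∀ i, mult lam i = (rowsOfCols I).count i := fun i => by rw [mult, hr]
    clear_value lam
    -- With `lam` fixed, only the multiplicities up to `J.length` enter; the head of a list
    -- contributes parts larger than the length of its tail.
    suffices ∀ (J : List ℕ), (∀ i, 1 ≤ i → i ≤ J.length → mult lam i = (rowsOfCols J).count i) →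
        cols lam J.length = J from this I fun i _ _ => hm i
    intro J
    induction J with
    | nil => exact fun _ => rfl
    | cons j J ih =>
      intro hJ
      have h0 : (rowsOfCols J).count (J.length + 1) = 0 := by
        rw [List.count_eq_zero]
        intro h
        have := le_of_mem_rowsOfCols J _ h
        omega
      rw [List.length_cons, cols, ih, hJ _ (by omega) (by simp), rowsOfCols, List.count_append, h0,
        List.count_replicate_self, add_zero]
      intro i h1 h2
      rw [hJ i h1 (by simp; omega), rowsOfCols, List.count_append, List.count_replicate, if_neg,
        zero_add]
      simp
      omega

/-! ### Row partition functions as kernels of the row action -/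

section kernel

variable {R : Type*} [CommSemiring R]

/-- The one-row partition function with free right boundary, as a function of column contents. -/
def rowKer (w : ℕ → Fin 2 → ℕ → Fin 2 → R) : Fin 2 → List ℕ → List ℕ → R
  | _, [], [] => 1
  | j, k :: K, i :: I => ∑ l : Fin 2, w i j k l * rowKer w l K I
  | _, _, _ => 0

theorem length_eq_of_rowKer_ne_zero (w : ℕ → Fin 2 → ℕ → Fin 2 → R) (j : Fin 2) (K I : List ℕ)
    (h : rowKer w j K I ≠ 0) : I.length = K.length := by
  induction K generalizing I j with
  | nil =>
    cases I with
    | nil => rfl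
    | cons i I => exact absurd rfl h
  | cons k K ih =>
    cases I with
    | nil => exact absurd rfl h
    | cons i I =>
      obtain ⟨l, -, hl⟩ := Finset.exists_ne_zero_of_sum_ne_zero h
      rw [List.length_cons, List.length_cons, ih l I (right_ne_zero_of_mul hl)]

/-- Given the horizontal states, conservation determines the lower contents, so the sum over `I`
collapses column by column. -/
theorem hasSum_rowKer [TopologicalSpace R] [IsTopologicalSemiring R]
    (w : ℕ → Fin 2 → ℕ → Fin 2 → R) (hw : ∀ I j K l, w I j K l ≠ 0 → I + (j : ℕ) = K + l)
    (v : List ℕ → R) (j : Fin 2) (K : List ℕ) :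
    HasSum (fun I => v I * rowKer w j K I) (rowAct w j v K) := by
  induction K generalizing j v with
  | nil =>
    have h := hasSum_single (f := fun I => v I * rowKer w j [] I) [] fun I hI => by
      cases I with
      | nil => exact absurd rfl hI
      | cons i I => simp [rowKer]
    simpa [rowKer, rowAct] using h
  | cons k K ih =>
    set f : Fin 2 → List ℕ → R := fun l I => match I with
      | [] => 0
      | i :: I => v (i :: I) * (w i j k l * rowKer w l K I) with hf
    have hsum : (fun I => v I * rowKer w j (k :: K) I) = fun I => ∑ l, f l I := by
      ext I
      cases I with
      | nil => simp [rowKer, hf]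
      | cons i I => simp only [rowKer, hf, Finset.mul_sum]
    rw [hsum]
    refine hasSum_sum fun l _ => ?_
    have hinj : Function.Injective fun I : List ℕ => (k + (l : ℕ) - (j : ℕ)) :: I := fun a b h => by
      simpa using h
    refine (hinj.hasSum_iff ?_).1 ?_
    · intro I hI
      cases I with
      | nil => rfl
      | cons i I =>
        have : w i j k l = 0 := by
          by_contra h0
          have := hw _ _ _ _ h0
          exact hI ⟨I, by simp; omega⟩
        simp only [hf, this, zero_mul, mul_zero]
    · have h := (ih (fun I => v ((k + (l : ℕ) - (j : ℕ)) :: I)) l).mul_left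
        (w (k + l - j) j k l)
      have e : (f l ∘ fun I : List ℕ => (k + (l : ℕ) - (j : ℕ)) :: I) = fun I =>
          w (k + l - j) j k l * (v ((k + (l : ℕ) - (j : ℕ)) :: I) * rowKer w l K I) :=
        funext fun I => mul_left_comm _ _ _
      rw [e]
      exact h

end kernel

theorem rowZ_succ (w : ℕ → Fin 2 → ℕ → Fin 2 → ℂ) (N : ℕ) (j l : Fin 2) (K I : ℕ → ℕ) :
    rowZ w (N + 1) j l K I = ∑ j' : Fin 2, w (I (N + 1)) j (K (N + 1)) j' * rowZ w N j' l K I := by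
  have hs (h : Fin (N + 1) → Fin 2) (a : Fin 2) :
      (Fin.snoc h a : Fin (N + 2) → Fin 2) 0 = h 0 := Fin.snoc_castSucc (α := fun _ => Fin 2) a h 0
  simp only [rowZ, Finset.sum_filter, Finset.mul_sum]
  rw [← (Fin.snocEquiv fun _ => Fin 2).sum_comp, Fintype.sum_prod_type, Finset.sum_eq_single j,
    Finset.sum_comm]
  · refine Finset.sum_congr rfl fun h _ => ?_
    rw [Finset.sum_eq_single (h (Fin.last N))]
    · simp only [Fin.snocEquiv, Equiv.coe_fn_mk, hs, Fin.snoc_last, true_and,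
        Fin.prod_univ_castSucc, Fin.val_last, Fin.succ_last, Fin.snoc_castSucc, Fin.val_castSucc,
        ← Fin.castSucc_succ, mul_ite, mul_zero]
      split_ifs
      · rw [mul_comm]
      · rfl
    · intro a _ ha
      simp [ha.symm]
    · simp
  · intro a _ ha
    refine Finset.sum_eq_zero fun h _ => if_neg ?_
    simp [Fin.snocEquiv, ha]
  · simp

theorem sum_rowZ_eq_rowKer (w : ℕ → Fin 2 → ℕ → Fin 2 → ℂ) (N : ℕ) (j : Fin 2)
    (top bot : YoungDiagram) :
    ∑ l : Fin 2, rowZ w N j l (mult top) (mult bot) = rowKer w j (cols top N) (cols bot N) := by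
  induction N generalizing j with
  | zero =>
    simp only [rowZ, cols, rowKer, Finset.univ_eq_empty, Finset.prod_empty, Finset.sum_filter,
      ← (Equiv.funUnique (Fin 1) (Fin 2)).symm.sum_comp]
    simp [ite_and]
  | succ N ih =>
    simp only [rowZ_succ, cols, rowKer]
    rw [Finset.sum_comm]
    simp only [← Finset.mul_sum, ih]

/-- The functional of partitions with largest part at most `N` given by a functional of their
column contents. -/
def onDiagrams (N : ℕ) (v : List ℕ → ℂ) (lam : YoungDiagram) : ℂ :=
  if lam.rowLen 0 ≤ N then v (cols lam N) else 0

/-- Diagrams with parts at most `N` correspond bijectively to lists of length `N`. -/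
theorem hasSum_onDiagrams (N : ℕ) (f : List ℕ → ℂ) (hf : ∀ I, I.length ≠ N → f I = 0) (a : ℂ)
    (h : HasSum f a) : HasSum (onDiagrams N f) a := by
  have hinj : Function.Injective fun lam : {lam : YoungDiagram | lam.rowLen 0 ≤ N} =>
      cols lam.1 N := fun a b hab => Subtype.ext (cols_injective a.2 b.2 hab)
  have h1 := (hinj.hasSum_iff (f := f) (a := a) ?_).2 h
  · have h2 := hasSum_subtype_iff_indicator.1
      (show HasSum ((fun lam => f (cols lam N)) ∘ ((↑) : {lam : YoungDiagram | lam.rowLen 0 ≤ N} → _)) a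
        from h1)
    convert h2 using 1
    ext lam
    simp [onDiagrams, Set.indicator]
  · intro I hI
    by_contra hne
    have hl : I.length = N := by
      by_contra h'
      exact hne (hf I h')
    obtain ⟨lam, hlam, hc⟩ := exists_cols_eq I
    rw [hl] at hlam hc
    exact hI ⟨⟨lam, hlam⟩, hc⟩

theorem hasSum_onDiagrams_row (w : ℕ → Fin 2 → ℕ → Fin 2 → ℂ)
    (hw : ∀ I j K l, w I j K l ≠ 0 → I + (j : ℕ) = K + l) (N : ℕ) (j : Fin 2)
    (hvac : ∀ k, w 0 j 0 k = if k = j then 1 else 0) (v : List ℕ → ℂ) (top : YoungDiagram)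
    (htop : top.rowLen 0 ≤ N) :
    HasSum (fun bot => onDiagrams N v bot * ∑ l : Fin 2, rowPF w j l top bot)
      (rowAct w j v (cols top N)) := by
  have h := hasSum_onDiagrams N _ (fun I hI => ?_) _ (hasSum_rowKer w hw v j (cols top N))
  · convert h using 2 with bot
    unfold onDiagrams
    split_ifs with hb
    · beta_reduce
      rw [← sum_rowZ_eq_rowKer]
      simp only [rowPF_eq_rowZ w j _ top bot hvac N htop hb]
    · rw [zero_mul]
  · by_contra hne
    exact hI ((length_eq_of_rowKer_ne_zero _ _ _ _ (right_ne_zero_of_mul hne)).trans (length_cols _ _))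

/-! ### Skew functions as iterated row actions -/

theorem hasSum_finsum_of_finite {α : Type*} {f : α → ℂ} (h : (Function.support f).Finite) :
    HasSum f (∑ᶠ a, f a) := by
  rw [finsum_eq_sum f h]
  refine hasSum_sum_of_ne_finset_zero fun a ha => ?_
  simpa using ha

theorem hasSum_swap_of_finite {α β : Type*} {f : α → β → ℂ} {g : α → ℂ} {g' : β → ℂ} {a : ℂ}
    (hf : {p : α × β | f p.1 p.2 ≠ 0}.Finite) (hg : ∀ i, HasSum (f i) (g i))
    (hg' : ∀ j, HasSum (fun i => f i j) (g' j)) (ha : HasSum g' a) : HasSum g a := by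
  have h := hasSum_finsum_of_finite (f := fun p : α × β => f p.1 p.2) hf
  have h1 := h.prod_fiberwise hg
  have h2 := ((Equiv.prodComm β α).hasSum_iff.2 h).prod_fiberwise hg'
  rwa [h2.unique ha] at h1

theorem exists_ne_zero_of_finsum {α : Type*} {f : α → ℂ} (h : ∑ᶠ a, f a ≠ 0) : ∃ a, f a ≠ 0 := by
  by_contra! h0
  exact h (by simp [h0])

theorem rowT_bounds {q s x : ℂ} {bot top : YoungDiagram} (h : rowT q s x bot top ≠ 0) :
    top.rowLen 0 ≤ bot.rowLen 0 ∧ bot.colLen 0 ≤ top.colLen 0 + 1 := by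
  obtain ⟨l, -, hl⟩ := Finset.exists_ne_zero_of_sum_ne_zero h
  obtain ⟨h1, h2, -⟩ := rowPF_bounds _ (weightL_conservation q s x) _ _ _ _ hl
  exact ⟨h2 rfl, by have := l.isLt; simp only [Fin.val_zero] at h1; omega⟩

theorem rowTstar_bounds {q s x : ℂ} {bot top : YoungDiagram} (h : rowTstar q s x bot top ≠ 0) :
    bot.rowLen 0 ≤ top.rowLen 0 ∧ bot.colLen 0 ≤ top.colLen 0 := by
  obtain ⟨l, -, hl⟩ := Finset.exists_ne_zero_of_sum_ne_zero h
  obtain ⟨h1, -, h2⟩ := rowPF_bounds _ (weightM_conservation q s x) _ _ _ _ hl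
  exact ⟨h2 rfl, by have := l.isLt; simp only [Fin.val_one] at h1; omega⟩

theorem skewF_bound {q s : ℂ} {n : ℕ} {x : Fin n → ℂ} {lam mu : YoungDiagram}
    (h : skewF q s n x lam mu ≠ 0) : lam.colLen 0 ≤ mu.colLen 0 + n := by
  induction n generalizing lam with
  | zero =>
    have : lam = mu := by
      by_contra hne
      exact h (if_neg hne)
    simp [this]
  | succ n ih =>
    obtain ⟨kap, hk⟩ := exists_ne_zero_of_finsum h
    have h1 := (rowT_bounds (left_ne_zero_of_mul hk)).2
    have h2 := ih (right_ne_zero_of_mul hk)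
    omega

theorem skewG_bound {q s : ℂ} {n : ℕ} {x : Fin n → ℂ} {mu nu : YoungDiagram}
    (h : skewG q s n x mu nu ≠ 0) : nu.rowLen 0 ≤ mu.rowLen 0 ∧ nu.colLen 0 ≤ mu.colLen 0 := by
  induction n generalizing mu with
  | zero =>
    have : nu = mu := by
      by_contra hne
      exact h (if_neg hne)
    simp [this]
  | succ n ih =>
    obtain ⟨kap, hk⟩ := exists_ne_zero_of_finsum h
    have h1 := rowTstar_bounds (right_ne_zero_of_mul hk)
    have h2 := ih (left_ne_zero_of_mul hk)
    omega

theorem finite_support_skewG (q s : ℂ) (n : ℕ) (x : Fin n → ℂ) (mu : YoungDiagram) :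
    (Function.support fun nu => skewG q s n x mu nu).Finite :=
  (finite_bounded (mu.rowLen 0) (mu.colLen 0)).subset fun _ h => skewG_bound h

theorem weightL_vac {q s x : ℂ} (hx : s * x ≠ 1) (k : Fin 2) :
    weightL q s x 0 0 0 k = if k = 0 then 1 else 0 := by
  have : 1 - s * x ≠ 0 := sub_ne_zero.2 hx.symm
  fin_cases k <;> simp [weightL, this]

theorem weightM_vac {q s x : ℂ} (hx : s * x ≠ 1) (k : Fin 2) :
    weightM q s x 0 1 0 k = if k = 1 then 1 else 0 := by
  have : 1 - s * x ≠ 0 := sub_ne_zero.2 hx.symm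
  fin_cases k <;> simp [weightM, this]

/-- The largest part cannot decrease downwards through a grey row, so the cut-off at `N` is
compatible with the row even when `top` exceeds it: both sides are then zero. -/
theorem hasSum_onDiagrams_rowT {q s x : ℂ} (hx : s * x ≠ 1) (N : ℕ) (v : List ℕ → ℂ)
    (top : YoungDiagram) :
    HasSum (fun bot => onDiagrams N v bot * rowT q s x bot top)
      (onDiagrams N (rowAct (weightL q s x) 0 v) top) := by
  by_cases htop : top.rowLen 0 ≤ N
  · rw [onDiagrams, if_pos htop]
    exact hasSum_onDiagrams_row _ (weightL_conservation q s x) N 0 (weightL_vac hx) v top htop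
  · rw [onDiagrams, if_neg htop]
    convert hasSum_zero using 1
    ext bot
    by_contra hne
    have h1 := (rowT_bounds (right_ne_zero_of_mul hne)).1
    have h2 := left_ne_zero_of_mul hne
    exact h2 (if_neg (by omega))

theorem hasSum_onDiagrams_rowTstar {q s x : ℂ} (hx : s * x ≠ 1) (N : ℕ) (v : List ℕ → ℂ)
    (top : YoungDiagram) (htop : top.rowLen 0 ≤ N) :
    HasSum (fun bot => onDiagrams N v bot * rowTstar q s x bot top)
      (rowAct (weightM q s x) 1 v (cols top N)) :=
  hasSum_onDiagrams_row _ (weightM_conservation q s x) N 1 (weightM_vac hx) v top htop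

theorem hasSum_onDiagrams_skewF (q s : ℂ) (n : ℕ) (x : Fin n → ℂ) (hx : ∀ i, s * x i ≠ 1) (N : ℕ)
    (v : List ℕ → ℂ) (mu : YoungDiagram) :
    HasSum (fun lam => onDiagrams N v lam * skewF q s n x lam mu)
      (onDiagrams N (stackAct n (fun i => weightL q s (x i)) 0 v) mu) := by
  induction n generalizing v with
  | zero =>
    have h := hasSum_single (f := fun lam => onDiagrams N v lam * skewF q s 0 x lam mu) mu
      fun lam h => by simp [skewF, h]
    simpa [skewF, stackAct] using h
  | succ n ih =>
    rw [stackAct_snoc]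
    refine hasSum_swap_of_finite (f := fun lam kap => onDiagrams N v lam *
      (rowT q s (x (Fin.last n)) lam kap * skewF q s n (fun i => x i.castSucc) kap mu))
      (g' := fun kap => onDiagrams N (rowAct (weightL q s (x (Fin.last n))) 0 v) kap *
        skewF q s n (fun i => x i.castSucc) kap mu) ?_ ?_ ?_
      (ih (fun i => x i.castSucc) (fun i => hx _) _)
    · refine ((finite_bounded N (mu.colLen 0 + n + 1)).prod
        (finite_bounded N (mu.colLen 0 + n))).subset ?_
      rintro ⟨lam, kap⟩ h
      have h1 : lam.rowLen 0 ≤ N := by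
        by_contra h0
        exact left_ne_zero_of_mul h (if_neg h0)
      have h2 := rowT_bounds (left_ne_zero_of_mul (right_ne_zero_of_mul h))
      have h3 := skewF_bound (right_ne_zero_of_mul (right_ne_zero_of_mul h))
      simp only [Set.mem_prod, Set.mem_ofPred_eq] at h2 h3 ⊢
      omega
    · intro lam
      refine (hasSum_finsum_of_finite ?_).mul_left _
      exact (finite_rowT q s (x (Fin.last n)) lam).subset fun kap h => left_ne_zero_of_mul h
    · intro kap
      simp only [← mul_assoc]
      exact (hasSum_onDiagrams_rowT (hx _) N v kap).mul_right _

theorem hasSum_rowTstar_mul_skewG (q s : ℂ) (n : ℕ) (x : Fin (n + 1) → ℂ) (a : YoungDiagram → ℂ)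
    (mu : YoungDiagram) :
    HasSum (fun kap => (∑ᶠ nu, a nu * skewG q s n (fun i => x i.castSucc) kap nu) *
      rowTstar q s (x (Fin.last n)) kap mu) (∑ᶠ nu, a nu * skewG q s (n + 1) x mu nu) := by
  refine hasSum_swap_of_finite (f := fun kap nu => a nu *
      skewG q s n (fun i => x i.castSucc) kap nu * rowTstar q s (x (Fin.last n)) kap mu)
      (g' := fun nu => a nu * skewG q s (n + 1) x mu nu) ?_ ?_ ?_ ?_
  · refine ((finite_bounded (mu.rowLen 0) (mu.colLen 0)).prod
        (finite_bounded (mu.rowLen 0) (mu.colLen 0))).subset ?_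
    rintro ⟨kap, nu⟩ h
    have h2 := rowTstar_bounds (right_ne_zero_of_mul h)
    have h3 := skewG_bound (right_ne_zero_of_mul (left_ne_zero_of_mul h))
    simp only [Set.mem_prod, Set.mem_ofPred_eq] at h2 h3 ⊢
    omega
  · intro kap
    refine (hasSum_finsum_of_finite ?_).mul_right _
    exact (finite_support_skewG q s n _ kap).subset fun nu h => right_ne_zero_of_mul h
  · intro nu
    simp only [mul_assoc]
    refine (hasSum_finsum_of_finite ?_).mul_left _
    exact (finite_rowTstar q s (x (Fin.last n)) mu).subset fun kap h => right_ne_zero_of_mul h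
  · refine hasSum_finsum_of_finite ?_
    exact (finite_support_skewG q s (n + 1) x mu).subset fun nu h => right_ne_zero_of_mul h

/-! ### Even conjugates and b^{el} as a product functional -/

theorem mult_succ_add_colLen (lam : YoungDiagram) (i : ℕ) :
    mult lam (i + 1) + lam.colLen (i + 1) = lam.colLen i := by
  have h : mult lam (i + 1) = (Finset.Ico (lam.colLen (i + 1)) (lam.colLen i)).card := by
    have e : Finset.Ico (lam.colLen (i + 1)) (lam.colLen i) =
        (Finset.range (lam.colLen 0)).filter fun r => lam.rowLen r = i + 1 := by
      ext r
      have h1 := YoungDiagram.mem_iff_lt_colLen (μ := lam) (i := r) (j := i)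
      have h2 := YoungDiagram.mem_iff_lt_colLen (μ := lam) (i := r) (j := i + 1)
      rw [YoungDiagram.mem_iff_lt_rowLen] at h1 h2
      have h3 := lam.colLen_anti 0 i (Nat.zero_le _)
      simp only [Finset.mem_Ico, Finset.mem_filter, Finset.mem_range]
      omega
    rw [e, mult, YoungDiagram.rowLens, List.count, List.countP_map, List.countP_eq_length_filter]
    have hn : ((List.range (lam.colLen 0)).filter fun r => decide (lam.rowLen r = i + 1)).Nodup :=
      List.nodup_range.filter _
    rw [← List.toFinset_card_of_nodup (by exact hn)]
    congr 1
    ext r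
    simp
  rw [h, Nat.card_Ico, Nat.sub_add_cancel (lam.colLen_anti i (i + 1) (Nat.le_succ i))]

/-- Multiplicities are differences of consecutive column lengths, and the column lengths vanish from
the largest part onwards. -/
theorem isEvenPartition_transpose_iff (lam : YoungDiagram) :
    IsEvenPartition lam.transpose ↔ ∀ i, 1 ≤ i → i ≤ lam.rowLen 0 → Even (mult lam i) := by
  simp only [IsEvenPartition, YoungDiagram.rowLen_transpose]
  constructor
  · intro h i hi _
    obtain ⟨i, rfl⟩ := Nat.exists_eq_add_of_le' hi
    have h1 := mult_succ_add_colLen lam i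
    have h2 := h i
    rw [← h1, Nat.even_add] at h2
    exact h2.2 (h (i + 1))
  · intro h
    have hz : ∀ r, lam.rowLen 0 ≤ r → lam.colLen r = 0 := fun r hr => by
      by_contra h0
      have := YoungDiagram.mem_iff_lt_rowLen.1
        (YoungDiagram.mem_iff_lt_colLen.2 (Nat.pos_of_ne_zero h0) : (0, r) ∈ lam)
      omega
    intro r
    obtain ⟨d, hd⟩ : ∃ d, d = lam.rowLen 0 - r := ⟨_, rfl⟩
    induction d generalizing r with
    | zero => simp [hz r (by omega)]
    | succ d ih =>
      rw [← mult_succ_add_colLen]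
      exact (h (r + 1) (by omega) (by omega)).add (ih (r + 1) (by omega))

theorem prodVec_cols {R : Type*} [CommSemiring R] (β : ℕ → R) (lam : YoungDiagram) (N : ℕ) :
    prodVec β (cols lam N) = ∏ i ∈ Finset.Icc 1 N, β (mult lam i) := by
  induction N with
  | zero => simp [cols, prodVec]
  | succ N ih => rw [cols, prodVec_cons, ih, Finset.prod_Icc_succ_top (by omega), mul_comm]

open Classical in
/-- The coefficient `b^{el}`, extended by zero to all partitions. -/
def belExt (q s : ℂ) (lam : YoungDiagram) : ℂ :=
  if IsEvenPartition lam.transpose then bel q s lam else 0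

theorem prodVec_cols_eq_belExt (q s : ℂ) (lam : YoungDiagram) (N : ℕ) (hN : lam.rowLen 0 ≤ N) :
    prodVec (evenWeight q s) (cols lam N) = belExt q s lam := by
  obtain ⟨M, rfl⟩ := Nat.exists_eq_add_of_le' hN
  rw [cols_add lam _ _ le_rfl]
  have h0 (K : List ℕ) :
      prodVec (evenWeight q s) (List.replicate M 0 ++ K) = prodVec (evenWeight q s) K := by
    simp [prodVec, evenWeight_zero]
  rw [h0, prodVec_cols, belExt]
  split_ifs with h
  · rw [isEvenPartition_transpose_iff] at h
    refine Finset.prod_congr rfl fun i hi => ?_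
    rw [Finset.mem_Icc] at hi
    rw [evenWeight, if_pos (h i hi.1 hi.2)]
  · rw [isEvenPartition_transpose_iff] at h
    push Not at h
    obtain ⟨i, h1, h2, h3⟩ := h
    refine Finset.prod_eq_zero (Finset.mem_Icc.2 ⟨h1, h2⟩) (evenWeight_of_not_even q s ?_)
    simpa using h3

theorem prod_prod_Ioi_castSucc {n : ℕ} (f : Fin (n + 1) → Fin (n + 1) → ℂ) :
    ∏ i, ∏ j ∈ Finset.Ioi i, f i j =
      (∏ i : Fin n, ∏ j ∈ Finset.Ioi i, f i.castSucc j.castSucc) *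
        ∏ i : Fin n, f i.castSucc (Fin.last n) := by
  have h1 : Finset.Ioi (Fin.last n) = ∅ := by
    ext i
    simpa using Fin.le_last i
  have h2 (i : Fin n) : Finset.Ioi i.castSucc =
      Finset.cons (Fin.last n) ((Finset.Ioi i).map Fin.castSuccEmb) (by simp) := by
    ext j
    refine Fin.lastCases ?_ (fun j => ?_) j <;> simp [Fin.castSucc_lt_last, Fin.le_last]
  rw [Fin.prod_univ_castSucc, h1, Finset.prod_empty, mul_one, ← Finset.prod_mul_distrib]
  refine Finset.prod_congr rfl fun i _ => ?_
  rw [h2, Finset.prod_cons, Finset.prod_map, mul_comm]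
  rfl

/-! ### Convergence under the admissibility condition -/

section admissible

variable {q s : ℂ} {n : ℕ} {x : Fin n → ℂ}

theorem norm_weightL_exc_mul_lt_one (hx : ∀ i, s * x i ≠ 1)
    (hadm : ∀ i j, i < j → ‖(x i - s) * (x j - s)‖ < ‖(1 - s * x i) * (1 - s * x j)‖)
    (i j : Fin n) (hij : i ≠ j) :
    ‖weightL q s (x i) 0 1 0 1‖ * ‖weightL q s (x j) 0 1 0 1‖ < 1 := by
  have key : ∀ i j, i < j → ‖weightL q s (x i) 0 1 0 1‖ * ‖weightL q s (x j) 0 1 0 1‖ < 1 := by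
    intro i j h
    have h1 : 0 < ‖(1 - s * x i) * (1 - s * x j)‖ :=
      norm_pos_iff.2 (mul_ne_zero (sub_ne_zero.2 (hx i).symm) (sub_ne_zero.2 (hx j).symm))
    rw [← norm_mul]
    simp only [weightL, if_true, pow_zero, mul_one]
    rw [div_mul_div_comm, norm_div, div_lt_one h1]
    exact hadm i j h
  rcases lt_or_gt_of_ne hij with h | h
  · exact key i j h
  · rw [mul_comm]
    exact key j i h

theorem norm_evenWeight_ne_zero {k : ℕ} (h : ‖evenWeight q s k‖ ≠ 0) : Even k := by
  by_contra h0
  exact h (by rw [evenWeight_of_not_even q s h0, norm_zero])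

theorem norm_weightL_vac_le (hx : ∀ i, s * x i ≠ 1) (i : Fin n) :
    ‖weightL q s (x i) 0 0 0 0‖ ≤ 1 := by
  rw [weightL_vac (hx i)]
  simp

theorem cols_add_rowLen (mu : YoungDiagram) (N : ℕ) :
    cols mu (N + mu.rowLen 0) = List.replicate N 0 ++ cols mu (mu.rowLen 0) :=
  cols_add mu _ N le_rfl

theorem tendsto_stackAct_excited (hx : ∀ i, s * x i ≠ 1)
    (hadm : ∀ i j, i < j → ‖(x i - s) * (x j - s)‖ < ‖(1 - s * x i) * (1 - s * x j)‖)
    (mu : YoungDiagram) (e : Fin n → Fin 2) (he : e ≠ 0) (hev : Even (∑ i, (e i : ℕ))) :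
    Tendsto (fun N => stackAct n (fun i => weightL q s (x i)) e (prodVec (evenWeight q s))
      (cols mu N)) atTop (𝓝 0) := by
  rw [← tendsto_add_atTop_iff_nat (mu.rowLen 0)]
  simp only [cols_add_rowLen]
  refine squeeze_zero_norm (fun N => norm_stackAct_le (fun K => (norm_prodVec _ K).le) e _) ?_
  refine (summable_stackAct_replicate (w := fun i I j K l => ‖weightL q s (x i) I j K l‖)
    (fun _ _ _ _ _ => norm_nonneg _)
    (fun i I j K l h => weightL_conservation q s (x i) I j K l (norm_ne_zero_iff.1 h))
    (norm_weightL_vac_le hx) (norm_weightL_exc_mul_lt_one hx hadm) (fun _ => norm_nonneg _)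
    (by rw [evenWeight_zero, norm_one]) (fun k => norm_evenWeight_ne_zero) _ e he hev).tendsto_atTop_zero

theorem exists_stackAct_abs_le (hx : ∀ i, s * x i ≠ 1)
    (hadm : ∀ i j, i < j → ‖(x i - s) * (x j - s)‖ < ‖(1 - s * x i) * (1 - s * x j)‖)
    (mu : YoungDiagram) : ∃ C, ∀ N, mu.rowLen 0 ≤ N →
      stackAct n (fun i I j K l => ‖weightL q s (x i) I j K l‖) 0
        (prodVec fun k => ‖evenWeight q s k‖) (cols mu N) ≤ C := by
  obtain ⟨C, hC⟩ := exists_stackAct_zero_le (w := fun i I j K l => ‖weightL q s (x i) I j K l‖)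
    (fun _ _ _ _ _ => norm_nonneg _)
    (fun i I j K l h => weightL_conservation q s (x i) I j K l (norm_ne_zero_iff.1 h))
    (norm_weightL_vac_le hx) (norm_weightL_exc_mul_lt_one hx hadm)
    (β := fun k => ‖evenWeight q s k‖) (fun _ => norm_nonneg _)
    (by rw [evenWeight_zero, norm_one]) (fun k => norm_evenWeight_ne_zero) (cols mu (mu.rowLen 0))
  refine ⟨C, fun N hN => ?_⟩
  obtain ⟨M, rfl⟩ := Nat.exists_eq_add_of_le' hN
  rw [cols_add_rowLen]
  exact hC M

/-- Finite sums of norms are bounded without expanding `skewF`: twisting `E` by phases turns such a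
sum into one stack value, dominated by the stack of absolute values. -/
theorem summable_belExt_mul_skewF (hx : ∀ i, s * x i ≠ 1)
    (hadm : ∀ i j, i < j → ‖(x i - s) * (x j - s)‖ < ‖(1 - s * x i) * (1 - s * x j)‖)
    (mu : YoungDiagram) : Summable fun lam => belExt q s lam * skewF q s n x lam mu := by
  obtain ⟨C, hC⟩ := exists_stackAct_abs_le (q := q) hx hadm mu
  refine Summable.of_norm (summable_of_sum_le (c := C) (fun _ => norm_nonneg _) fun t => ?_)
  set N := max (t.sup fun lam => lam.rowLen 0) (mu.rowLen 0) with hN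
  have hmu : mu.rowLen 0 ≤ N := le_max_right _ _
  have ht : ∀ lam ∈ t, lam.rowLen 0 ≤ N := fun lam h =>
    (Finset.le_sup (f := fun lam : YoungDiagram => lam.rowLen 0) h).trans (le_max_left _ _)
  have hphase (z : ℂ) : ∃ u : ℂ, ‖u‖ ≤ 1 ∧ u * z = ‖z‖ := by
    by_cases hz : z = 0
    · exact ⟨0, by simp, by simp [hz]⟩
    · have hz' : (‖z‖ : ℂ) ≠ 0 := by simpa using hz
      refine ⟨‖z‖ / z, ?_, div_mul_cancel₀ _ hz⟩
      rw [norm_div, Complex.norm_real, norm_norm]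
      exact div_self_le_one _
  choose u hu1 hu using fun lam => hphase (belExt q s lam * skewF q s n x lam mu)
  classical
  set c : {lam : YoungDiagram // lam.rowLen 0 ≤ N} → List ℕ := fun lam => cols lam.1 N with hc
  have hinj : Function.Injective c := fun a b hab => Subtype.ext (cols_injective a.2 b.2 hab)
  -- The phases on the contents of diagrams in `t`, and zero on all other lists.
  set p : List ℕ → ℂ := Function.extend c (fun lam => if lam.1 ∈ t then u lam.1 else 0) 0 with hp
  have hp1 : ∀ K, ‖p K‖ ≤ 1 := by
    intro K
    by_cases hK : ∃ a, c a = K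
    · obtain ⟨a, rfl⟩ := hK
      rw [hp, hinj.extend_apply]
      split_ifs
      · exact hu1 _
      · simp
    · rw [hp, Function.extend_apply' _ _ _ hK]
      simp
  have hon : ∀ lam, onDiagrams N (fun K => p K * prodVec (evenWeight q s) K) lam =
      if lam ∈ t then u lam * belExt q s lam else 0 := by
    intro lam
    rw [onDiagrams]
    by_cases h : lam.rowLen 0 ≤ N
    · have h1 : p (cols lam N) = if lam ∈ t then u lam else 0 := hinj.extend_apply _ _ ⟨lam, h⟩
      rw [if_pos h, prodVec_cols_eq_belExt q s lam N h, h1, ite_mul, zero_mul]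
    · rw [if_neg h, if_neg fun h' => h (ht lam h')]
  have h1 := hasSum_onDiagrams_skewF q s n x hx N (fun K => p K * prodVec (evenWeight q s) K) mu
  have h2 : HasSum (fun lam => onDiagrams N (fun K => p K * prodVec (evenWeight q s) K) lam *
      skewF q s n x lam mu) (∑ lam ∈ t, (‖belExt q s lam * skewF q s n x lam mu‖ : ℂ)) := by
    rw [← Finset.sum_congr rfl fun lam hl => (show onDiagrams N
      (fun K => p K * prodVec (evenWeight q s) K) lam * skewF q s n x lam mu = _ by
        rw [hon, if_pos hl, mul_assoc, hu])]
    exact hasSum_sum_of_ne_finset_zero fun lam hl => by rw [hon, if_neg hl, zero_mul]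
  have h3 := h2.unique h1
  rw [onDiagrams, if_pos hmu] at h3
  rw [← Complex.ofReal_sum] at h3
  have hle (K : List ℕ) : ‖p K * prodVec (evenWeight q s) K‖ ≤
      prodVec (fun k => ‖evenWeight q s k‖) K := by
    rw [norm_mul, norm_prodVec]
    exact mul_le_of_le_one_left (prodVec_nonneg (fun _ => norm_nonneg _) K) (hp1 K)
  calc _ ≤ ‖((∑ lam ∈ t, ‖belExt q s lam * skewF q s n x lam mu‖ : ℝ) : ℂ)‖ := by
        rw [Complex.norm_real]
        exact Real.le_norm_self _
    _ ≤ _ := by rw [h3]; exact norm_stackAct_le hle 0 _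
    _ ≤ C := hC N hmu

theorem tendsto_stackAct_tsum (hx : ∀ i, s * x i ≠ 1)
    (hadm : ∀ i j, i < j → ‖(x i - s) * (x j - s)‖ < ‖(1 - s * x i) * (1 - s * x j)‖)
    (mu : YoungDiagram) :
    Tendsto (fun N => stackAct n (fun i => weightL q s (x i)) 0 (prodVec (evenWeight q s))
      (cols mu N)) atTop (𝓝 (∑' lam, belExt q s lam * skewF q s n x lam mu)) := by
  have hs := summable_belExt_mul_skewF (q := q) hx hadm mu
  have hon (N : ℕ) (lam : YoungDiagram) : onDiagrams N (prodVec (evenWeight q s)) lam =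
      if lam.rowLen 0 ≤ N then belExt q s lam else 0 := by
    rw [onDiagrams]
    split_ifs with h
    · exact prodVec_cols_eq_belExt q s lam N h
    · rfl
  have h := tendsto_tsum_of_dominated_convergence (𝓕 := atTop)
    (f := fun N lam => onDiagrams N (prodVec (evenWeight q s)) lam * skewF q s n x lam mu)
    (g := fun lam => belExt q s lam * skewF q s n x lam mu) hs.norm ?_ ?_
  · refine h.congr' ?_
    filter_upwards [eventually_ge_atTop (mu.rowLen 0)] with N hN
    rw [(hasSum_onDiagrams_skewF q s n x hx N _ mu).tsum_eq, onDiagrams, if_pos hN]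
  · intro lam
    refine tendsto_const_nhds.congr' ?_
    filter_upwards [eventually_ge_atTop (lam.rowLen 0)] with N hN
    rw [hon, if_pos hN]
  · refine Eventually.of_forall fun N lam => ?_
    rw [hon]
    split_ifs
    · exact le_rfl
    · rw [zero_mul, norm_zero]
      exact norm_nonneg _

end admissible

/-- The two products differ by (s² - 1)(1 - ab), so they would coincide if ab = 1. -/
theorem one_sub_mul_ne_zero_of_norm_lt {s a b : ℂ}
    (h : ‖(a - s) * (b - s)‖ < ‖(1 - s * a) * (1 - s * b)‖) : 1 - a * b ≠ 0 := by
  intro h0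
  have : (a - s) * (b - s) = (1 - s * a) * (1 - s * b) := by
    linear_combination (s ^ 2 - 1) * h0
  rw [this] at h
  exact lt_irrefl _ h

/-! ### Induction on the number of variables -/

/-- The truncated sums converge to the right-hand side of the skew Littlewood identity. -/
theorem tendsto_stackAct_skewG (q s : ℂ) (hqs : ∀ k : ℕ, 1 ≤ k → s ^ 2 * q ^ (2 * k - 1) ≠ 1)
    (n : ℕ) (x : Fin n → ℂ) (hx : ∀ i, s * x i ≠ 1)
    (hadm : ∀ i j, i < j → ‖(x i - s) * (x j - s)‖ < ‖(1 - s * x i) * (1 - s * x j)‖)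
    (mu : YoungDiagram) :
    Tendsto (fun N => stackAct n (fun i => weightL q s (x i)) 0 (prodVec (evenWeight q s))
      (cols mu N)) atTop
      (𝓝 ((∏ i : Fin n, ∏ j ∈ Finset.Ioi i, (1 - q * x i * x j) / (1 - x i * x j)) *
        ∑ᶠ nu, belExt q s nu * skewG q s n x mu nu)) := by
  induction n generalizing mu with
  | zero =>
    refine tendsto_const_nhds.congr' ?_
    filter_upwards [eventually_ge_atTop (mu.rowLen 0)] with N hN
    rw [stackAct, prodVec_cols_eq_belExt q s mu N hN, finsum_eq_single _ mu]
    · simp [skewG]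
    · intro nu h
      simp [skewG, h]
  | succ n ih =>
    set y := x (Fin.last n) with hy
    set x' : Fin n → ℂ := fun i => x i.castSucc with hx'
    set E := prodVec (evenWeight q s) with hE
    set L : Fin n → ℕ → Fin 2 → ℕ → Fin 2 → ℂ := fun i => weightL q s (x' i) with hL
    have hne : ∏ i, (1 - x' i * y) ≠ 0 := Finset.prod_ne_zero_iff.2 fun i _ =>
      one_sub_mul_ne_zero_of_norm_lt (hadm i.castSucc (Fin.last n) (Fin.castSucc_lt_last i))
    have ih' := ih x' (fun i => hx _) (fun i j hij => hadm _ _ (Fin.castSucc_lt_castSucc_iff.2 hij))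
    obtain ⟨C, hC⟩ := (exists_exchange_stack q s y n x').2
    have hrefl0 : rowAct (weightL q s y) 0 E = rowAct (weightM q s y) 1 E :=
      funext fun K => (rowAct_reflect q s y hqs K).1
    have hrefl1 : rowAct (weightL q s y) 1 E = rowAct (weightM q s y) 0 E :=
      funext fun K => (rowAct_reflect q s y hqs K).2
    have hstack (e : Fin n → Fin 2) (j : Fin 2) : stackAct (n + 1) (fun i => weightL q s (x i))
        (Fin.snoc e j) E = stackAct n L e (rowAct (weightL q s y) j E) := by
      rw [stackAct_snoc, Fin.init_snoc, Fin.snoc_last]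
      rfl
    have hzero : (0 : Fin (n + 1) → Fin 2) = Fin.snoc (α := fun _ => Fin 2) (0 : Fin n → Fin 2) 0 := by
      ext i
      refine Fin.lastCases ?_ (fun i => ?_) i <;> simp
    have herr (k : Fin n) : Tendsto (fun N => stackAct n L (Pi.single k 1)
        (rowAct (weightM q s y) 0 E) (cols mu N)) atTop (𝓝 0) := by
      -- Reflection turns the red row in state 0 into a grey row in state 1. Together with row `k`
      -- this makes two excitations, an even nonzero state to which the decay applies.
      simp only [← hrefl1, ← hstack]
      refine tendsto_stackAct_excited hx hadm mu _ (fun h => ?_) ?_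
      · have := congrFun h (Fin.last n)
        simp at this
      · have h1 : ∑ i : Fin n, ((Pi.single k 1 : Fin n → Fin 2) i : ℕ) = 1 := by
          rw [Finset.sum_eq_single k]
          · simp
          · intro i _ hi
            simp [hi]
          · simp
        rw [Fin.sum_univ_castSucc]
        simp only [Fin.snoc_castSucc, Fin.snoc_last, h1]
        decide
    have hB : Tendsto (fun N => rowAct (weightM q s y) 1 (stackAct n L 0 E) (cols mu N)) atTop
        (𝓝 ((∏ i : Fin n, ∏ j ∈ Finset.Ioi i, (1 - q * x' i * x' j) / (1 - x' i * x' j)) *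
          ∑ᶠ nu, belExt q s nu * skewG q s (n + 1) x mu nu)) := by
      -- The finite set `t` of partitions below the red row does not depend on `N`, so the induction
      -- hypothesis can be used term by term.
      set t := (finite_rowTstar q s y mu).toFinset with ht
      have hout : ∀ kap, kap ∉ t → rowTstar q s y kap mu = 0 := fun kap h => by
        simpa [ht] using h
      have hlim : Tendsto (fun N => ∑ kap ∈ t, onDiagrams N (stackAct n L 0 E) kap *
          rowTstar q s y kap mu) atTop (𝓝 (∑ kap ∈ t,
          ((∏ i : Fin n, ∏ j ∈ Finset.Ioi i, (1 - q * x' i * x' j) / (1 - x' i * x' j)) *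
            ∑ᶠ nu, belExt q s nu * skewG q s n x' kap nu) * rowTstar q s y kap mu)) := by
        refine tendsto_finsetSum _ fun kap _ => Tendsto.mul_const _ ((ih' kap).congr' ?_)
        filter_upwards [eventually_ge_atTop (kap.rowLen 0)] with N hN
        rw [onDiagrams, if_pos hN]
      have h1 := (hasSum_rowTstar_mul_skewG q s n x (belExt q s) mu).unique
        (hasSum_sum_of_ne_finset_zero (s := t) fun kap h => by rw [hout kap h, mul_zero])
      rw [h1, Finset.mul_sum]
      simp only [mul_assoc] at hlim ⊢
      refine hlim.congr' ?_
      filter_upwards [eventually_ge_atTop (mu.rowLen 0)] with N hN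
      exact (hasSum_sum_of_ne_finset_zero fun kap h => by rw [hout kap h, mul_zero]).unique
        (hasSum_onDiagrams_rowTstar (hx _) N _ mu hN)
    have hall := ((hB.const_mul (∏ i, (1 - q * x' i * y))).sub
      (tendsto_finsetSum Finset.univ fun k _ => (herr k).const_mul (C k))).div_const
        (∏ i, (1 - x' i * y))
    rw [prod_prod_Ioi_castSucc, Finset.prod_div_distrib (s := Finset.univ)
      (f := fun i : Fin n => 1 - q * x i.castSucc * x (Fin.last n))]
    convert hall using 1
    · ext N
      -- The exchange relation is solved for the stack with the red row at the bottom, which is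
      -- possible because `hne` allows division.
      rw [hzero, hstack, hrefl0, hC, add_sub_cancel_right, mul_div_cancel_left₀ _ hne]
    · congr 1
      simp only [mul_zero, Finset.sum_const_zero, sub_zero]
      ring

end SpinHL

end

theorem theorem3p4 (q s : ℂ) (hqs : ∀ k : ℕ, 1 ≤ k → s ^ 2 * q ^ (2 * k - 1) ≠ 1)
    (n : ℕ) (x : Fin n → ℂ) (hx : ∀ i, s * x i ≠ 1)
    (hadm : ∀ i j, i < j → ‖(x i - s) * (x j - s)‖ < ‖(1 - s * x i) * (1 - s * x j)‖)
    (mu : YoungDiagram) :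
    Summable (fun lam : {lam : YoungDiagram // SpinHL.IsEvenPartition lam.transpose} =>
        SpinHL.bel q s lam * SpinHL.skewF q s n x lam mu) ∧
    (Function.support (fun nu : {nu : YoungDiagram // SpinHL.IsEvenPartition nu.transpose} =>
        SpinHL.bel q s nu * SpinHL.skewG q s n x mu nu)).Finite ∧
    ∑' lam : {lam : YoungDiagram // SpinHL.IsEvenPartition lam.transpose},
        SpinHL.bel q s lam * SpinHL.skewF q s n x lam mu =
      (∏ i : Fin n, ∏ j ∈ Finset.Ioi i, (1 - q * x i * x j) / (1 - x i * x j)) *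
        ∑ᶠ nu : {nu : YoungDiagram // SpinHL.IsEvenPartition nu.transpose},
          SpinHL.bel q s nu * SpinHL.skewG q s n x mu nu := by
  have hbel (lam : {lam : YoungDiagram // SpinHL.IsEvenPartition lam.transpose}) :
      SpinHL.bel q s lam = SpinHL.belExt q s lam := (if_pos lam.2).symm
  have hsupp (f : YoungDiagram → ℂ) : Function.support (fun lam => SpinHL.belExt q s lam * f lam) ⊆
      {lam | SpinHL.IsEvenPartition lam.transpose} := fun lam h => by
    by_contra h0
    exact left_ne_zero_of_mul h (if_neg h0)
  have hfin : (Function.support (fun nu : {nu : YoungDiagram //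
      SpinHL.IsEvenPartition nu.transpose} =>
        SpinHL.belExt q s nu * SpinHL.skewG q s n x mu nu)).Finite :=
    ((SpinHL.finite_support_skewG q s n x mu).preimage Subtype.val_injective.injOn).subset
      fun nu h => right_ne_zero_of_mul h
  have hfin' : (Function.support
      (fun nu => SpinHL.belExt q s nu * SpinHL.skewG q s n x mu nu)).Finite :=
    (SpinHL.finite_support_skewG q s n x mu).subset fun nu h => right_ne_zero_of_mul h
  have hsum := SpinHL.summable_belExt_mul_skewF (q := q) hx hadm mu
  simp only [hbel]
  refine ⟨hsum.subtype _, hfin, ?_⟩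
  -- Both sides are limits of the same truncated stacks.
  have h1 := tendsto_nhds_unique (SpinHL.tendsto_stackAct_tsum (q := q) hx hadm mu)
    (SpinHL.tendsto_stackAct_skewG q s hqs n x hx hadm mu)
  rw [← (SpinHL.hasSum_finsum_of_finite hfin').tsum_eq] at h1
  rw [← (SpinHL.hasSum_finsum_of_finite hfin).tsum_eq]
  have h2 := tsum_subtype_eq_of_support_subset (hsupp fun lam => SpinHL.skewF q s n x lam mu)
  have h3 := tsum_subtype_eq_of_support_subset (hsupp fun nu => SpinHL.skewG q s n x mu nu)
  rw [← h2, ← h3] at h1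
  exact h1
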